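/- **Calapso transforms preserve spherical curvature lines.** Let $\mathbb{R}^{4,2}$ be $\mathbb{R}^6$ with a symmetric bilinear form $(\cdot,\cdot)$ of signature $(4,2)$; write $\wedge^2\mathbb{R}^{4,2}=\mathfrak{o}(4,2)$ via $(a\wedge b)c=(a,c)b-(b,c)a$. Let $\Sigma$ be a smooth surface and let $f\colon\Sigma\to\mathcal Z$ be a regular umbilic-free Legendre map into the Grassmannian of null 2-planes of $\mathbb{R}^{4,2}$, viewed as a null rank 2 subbundle $f$ of $\Sigma\times\mathbb{R}^{4,2}$. Thus $d\sigma$ takes values in $f^\perp$ for all sections $\sigma$ of $f$; a vector $X$ with $d_X\sigma\in f$ for all sections $\sigma$ of $f$ is zero; $f$ has two smooth curvature sphere congruences $s_1,s_2\le f$ with $s_1\cap s_2=0$, whose curvature subbundles $T_i=\{X: d_X\sigma\in f \text{ for all sections } \sigma \text{ of } s_i\}$ are non-zero at each point; and $s_1,s_2$ are immersions into the Lie quadric (the projectivised light cone). Let $\eta\in\Omega^1(f\wedge f^\perp)$ be a gauge potential of $f$, i.e. $\eta$ is smooth, $d\eta=[\eta\wedge\eta]=0$, and the quadratic differential $(X,Y)\mapsto\mathrm{tr}(f\to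 f:\sigma\mapsto\eta(X)d_Y\sigma)$ is not identically zero; so $f$ is Lie applicable. Let $t\in\mathbb{R}$, let $T(t)\colon\Sigma\to \mathrm{O}(4,2)$ be any smooth map with $T(t)\cdot(d+t\eta)=d$, and let $f^t=T(t)f$ be the resulting Calapso transform. *Definitions.* For a timelike $\mathfrak p\in\mathbb{R}^{4,2}$, a Legendre map $g$ has spherical curvature lines along the leaves of its curvature subbundle $T_i$ in the conformal geometry $\langle\mathfrak p\rangle^\perp$ if there is a smooth map $\nu$ from $\Sigma$ into the Lie quadric, constant along the leaves of $T_i$, such that $\nu$ is orthogonal to the point sphere map $g\cap\langle\mathfrak p\rangle^\perp$, and such that the spheres $\nu$ are transversal to the surface: $g\cap(\nu\oplus\langle\mathfrak p\rangle)=0$ at every point. The Lie cyclides of $g$, with curvature spheres $s_1,s_2$, are $S_1=\langle\sigma_1,d_Y\sigma_1,d_Yd_Y\sigma_1\rangle$ and $S_2=\langle\sigma_2,d_X\sigma_2,d_Xd_X\sigma_2\rangle$ for nowhere zero local sections $\sigma_i$ of $s_i$, $X$ of $T_1$ and $Y$ of $T_2$. One has $\Sigma\times\mathbb{R}^{4,2}=S_1\oplus_\perp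 S_2$ and $d=\mathcal D+\mathcal N$, with $\mathcal D$ the sum of the connections induced on $S_1,S_2$ and $\mathcal N\in\Omega^1(S_1\wedge S_2)$. The osculating complexes of $g$ are $L_i=\ker\mathcal N(T_i)\cap S_i\cap g^\perp$. *Then:* $f^t$ is a regular umbilic-free Legendre map with curvature spheres $T(t)s_1,T(t)s_2$ and the same curvature subbundles $T_1,T_2$ as $f$, and for each $i\in\{1,2\}$: 1. for all timelike $\mathfrak p,\mathfrak q\in\mathbb{R}^{4,2}$, $f$ has spherical curvature lines along the leaves of $T_i$ in the geometry $\langle\mathfrak p\rangle^\perp$ if and only if $f^t$ has spherical curvature lines along the leaves of $T_i$ in the geometry $\langle\mathfrak q\rangle^\perp$ (in particular, the property does not depend on the choice of the conformal geometry, and it holds for $f$ if and only if it holds for any, equivalently every, Calapso transform $f^t$); 2. the osculating complexes $L_i^t$ of $f^t$ are $L_i^t=T(t)L_i$. -/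

import Mathlib

open scoped Manifold ContDiff Topology

noncomputable section

namespace LieSphere

/-! ### The pseudo-Euclidean space of signature (4,2) -/

/-- The vector space underlying `ℝ^{4,2}`. -/
abbrev R42 : Type := Fin 6 → ℝ

/-- The symmetric bilinear form `x₀y₀ + x₁y₁ + x₂y₂ + x₃y₃ - x₄y₄ - x₅y₅`. -/
def form : LinearMap.BilinForm ℝ R42 :=
  Matrix.toBilin' (Matrix.diagonal ![1, 1, 1, 1, -1, -1])

/-- The orthogonal complement of a subspace. -/
def perp (W : Submodule ℝ R42) : Submodule ℝ R42 := form.orthogonal W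

/-- A vector `a ∧ b` of the second exterior power, as a skew endomorphism:
`(a ∧ b) c = (a, c) b - (b, c) a`. -/
def wedge (a b : R42) : R42 →L[ℝ] R42 :=
  LinearMap.toContinuousLinearMap
    ((form a).smulRight b - (form b).smulRight a)

/-- The space `A ∧ B` spanned by all `a ∧ b` with `a ∈ A` and `b ∈ B`. -/
def wedgeSpace (A B : Submodule ℝ R42) : Submodule ℝ (R42 →L[ℝ] R42) :=
  Submodule.span ℝ {w | ∃ a ∈ A, ∃ b ∈ B, w = wedge a b}

variable {M : Type*} [TopologicalSpace M] [ChartedSpace (EuclideanSpace ℝ (Fin 2)) M]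

/-! ### Subbundles of the trivial bundle, their sections, and derivatives -/

/-- The derivative `d_X σ` at `x` of an `ℝ^{4,2}`-valued map. -/
def dirDeriv (σ : M → R42) (x : M) (X : TangentSpace (𝓡 2) x) : R42 :=
  mfderiv (𝓡 2) 𝓘(ℝ, R42) σ x X

/-- `σ` restricts to a smooth section of `f` over the open set `U`. -/
structure IsSection (f : M → Submodule ℝ R42) (U : Set M) (σ : M → R42) : Prop where
  isOpen : IsOpen U
  smooth : ContMDiffOn (𝓡 2) 𝓘(ℝ, R42) ∞ σ U
  mem : ∀ y ∈ U, σ y ∈ f y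

/-- `f` is a smooth rank `k` subbundle of the trivial bundle `M × ℝ^{4,2}`:
it has a smooth local frame around every point. -/
def IsSubbundle (k : ℕ) (f : M → Submodule ℝ R42) : Prop :=
  ∀ x : M, ∃ (U : Set M) (σ : Fin k → M → R42), x ∈ U ∧ (∀ j, IsSection f U (σ j)) ∧
    ∀ y ∈ U, LinearIndependent ℝ (fun j => σ j y) ∧
      Submodule.span ℝ (Set.range fun j => σ j y) = f y

/-- A field of tangent subspaces. -/
abbrev Distribution (M : Type*) [TopologicalSpace M]
    [ChartedSpace (EuclideanSpace ℝ (Fin 2)) M] : Type _ :=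
  (x : M) → Submodule ℝ (TangentSpace (𝓡 2) x)

/-- `Y` restricts to a smooth vector field over the open set `U` that is tangent to `D`. -/
structure IsTangentField [IsManifold (𝓡 2) ∞ M] (D : Distribution M) (U : Set M)
    (Y : (x : M) → TangentSpace (𝓡 2) x) : Prop where
  isOpen : IsOpen U
  smooth : ContMDiffOn (𝓡 2) (𝓡 2).tangent ∞
    (fun y => (⟨y, Y y⟩ : TangentBundle (𝓡 2) M)) U
  mem : ∀ y ∈ U, Y y ∈ D y

/-- A subbundle is constant along the leaves of `D`: derivatives of its sections in the
directions of `D` are again in the subbundle. -/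
def IsConstantAlong (D : Distribution M) (L : M → Submodule ℝ R42) : Prop :=
  ∀ (U : Set M) (σ : M → R42), IsSection L U σ → ∀ x ∈ U, ∀ X ∈ D x, dirDeriv σ x X ∈ L x

/-! ### Legendre maps and curvature spheres -/

/-- Legendre maps of a surface into the Grassmannian of null 2-planes of `ℝ^{4,2}`. -/
structure IsLegendre (f : M → Submodule ℝ R42) : Prop where
  subbundle : IsSubbundle 2 f
  null : ∀ x, f x ≤ perp (f x)
  contact : ∀ (U : Set M) (σ : M → R42), IsSection f U σ → ∀ x ∈ U,
    ∀ X : TangentSpace (𝓡 2) x, dirDeriv σ x X ∈ perp (f x)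
  immersed : ∀ (x : M) (X : TangentSpace (𝓡 2) x),
    (∀ (U : Set M) (σ : M → R42), IsSection f U σ → x ∈ U → dirDeriv σ x X ∈ f x) → X = 0

/-- The largest space of tangent vectors `X` at `x` such that `d_X σ ∈ f(x)` for all sections
`σ` of `f` with `σ(x) ∈ S`. -/
def curvatureSpace (f : M → Submodule ℝ R42) (S : Submodule ℝ R42) (x : M) :
    Submodule ℝ (TangentSpace (𝓡 2) x) where
  carrier := {X | ∀ (U : Set M) (σ : M → R42), IsSection f U σ → x ∈ U → σ x ∈ S →
    dirDeriv σ x X ∈ f x}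
  zero_mem' := by
    intro U σ _ _ _
    simp only [dirDeriv, map_zero]
    exact (f x).zero_mem
  add_mem' := by
    intro X Y hX hY U σ h hx hS
    simp only [dirDeriv, map_add]
    exact (f x).add_mem (hX U σ h hx hS) (hY U σ h hx hS)
  smul_mem' := by
    intro c X hX U σ h hx hS
    simp only [dirDeriv, map_smul]
    exact (f x).smul_mem c (hX U σ h hx hS)

/-- `S` is a curvature sphere of `f` at `x`. -/
def IsCurvatureSphere (f : M → Submodule ℝ R42) (x : M) (S : Submodule ℝ R42) : Prop :=
  Module.finrank ℝ S = 1 ∧ S ≤ f x ∧ curvatureSpace f S x ≠ ⊥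

/-- The surface `f` is umbilic-free with curvature sphere congruences `s 0` and `s 1`. -/
structure IsUmbilicFree (f : M → Submodule ℝ R42) (s : Fin 2 → M → Submodule ℝ R42) :
    Prop where
  subbundle : ∀ i, IsSubbundle 1 (s i)
  curvatureSphere : ∀ i x, IsCurvatureSphere f x (s i x)
  disjoint : ∀ x, Disjoint (s 0 x) (s 1 x)

/-- The curvature subbundle `T_i` of the curvature sphere congruence `s i`. -/
def curvatureBundle (f : M → Submodule ℝ R42) (s : Fin 2 → M → Submodule ℝ R42)
    (i : Fin 2) : Distribution M :=
  fun x => curvatureSpace f (s i x) x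

/-- Regularity: both curvature sphere congruences are immersions into the Lie quadric. -/
def IsRegularPair (s : Fin 2 → M → Submodule ℝ R42) : Prop :=
  ∀ (i : Fin 2) (x : M) (X : TangentSpace (𝓡 2) x),
    (∀ (U : Set M) (σ : M → R42), IsSection (s i) U σ → x ∈ U → dirDeriv σ x X ∈ s i x) → X = 0

/-! ### Spherical curvature lines -/

/-- In the conformal geometry with timelike point sphere complex `p`, the point sphere map
`f ∩ p^⊥` has spherical lines along the leaves of `D`: it is orthogonal to a smooth map `ν`
into the Lie quadric that is constant along the leaves of `D`. The last condition says that the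
spheres meet the surface transversally: the sphere of `ν(x)`, with either orientation
(the null lines of `ν(x) ⊕ ⟨p⟩`), is not one of the spheres of the contact element `f(x)`. -/
def IsSphericalAlong (p : R42) (f : M → Submodule ℝ R42) (D : Distribution M) : Prop :=
  ∃ ν : M → Submodule ℝ R42, IsSubbundle 1 ν ∧ (∀ x, ν x ≤ perp (ν x)) ∧
    IsConstantAlong D ν ∧
    (∀ x, f x ⊓ perp (Submodule.span ℝ {p}) ≤ perp (ν x)) ∧
    ∀ x, Disjoint (f x) (ν x ⊔ Submodule.span ℝ {p})

/-! ### Lie cyclides and osculating sphere complexes -/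

/-- The Lie cyclide `S_i`, spanned by `σ`, `d_Y σ` and `d_Y d_Y σ` for sections `σ` of `s i` and
vector fields `Y` in the other curvature subbundle. (The span of these three vectors is the
same for all nowhere zero `σ` and `Y`.) -/
def lieCyclide [IsManifold (𝓡 2) ∞ M] (f : M → Submodule ℝ R42)
    (s : Fin 2 → M → Submodule ℝ R42) (i : Fin 2) (x : M) : Submodule ℝ R42 :=
  Submodule.span ℝ {v | ∃ (U : Set M) (σ : M → R42) (Y : (y : M) → TangentSpace (𝓡 2) y),
    x ∈ U ∧ IsSection (s i) U σ ∧ IsTangentField (curvatureBundle f s i.rev) U Y ∧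
    (v = σ x ∨ v = dirDeriv σ x (Y x) ∨ v = dirDeriv (fun y => dirDeriv σ y (Y y)) x (Y x))}

/-- Given the splitting of the trivial bundle into a subbundle `S` and its orthogonal complement,
with `d = 𝒟 + 𝒩` where `𝒟` is the sum of the induced connections, this is the space of all
`v ∈ S(x)` with `𝒩(X) v = 0`. For `v = σ(x)` with a section `σ` of `S`, the vector `𝒩(X) v`
is the component of `d_X σ` in `S(x)^⊥`, so that it vanishes when `d_X σ ∈ S(x)`. -/
def kerN (S : M → Submodule ℝ R42) (x : M) (X : TangentSpace (𝓡 2) x) :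
    Submodule ℝ R42 where
  carrier := {v | ∃ (U : Set M) (σ : M → R42), x ∈ U ∧ IsSection S U σ ∧ σ x = v ∧
    dirDeriv σ x X ∈ S x}
  zero_mem' := by
    refine ⟨Set.univ, fun _ => 0, Set.mem_univ x,
      ⟨isOpen_univ, contMDiffOn_const, fun y _ => (S y).zero_mem⟩, rfl, ?_⟩
    simp only [dirDeriv, mfderiv_const]
    exact (S x).zero_mem
  add_mem' := by
    rintro v w ⟨U, σ, hU, hσ, rfl, hσX⟩ ⟨V, τ, hV, hτ, rfl, hτX⟩
    refine ⟨U ∩ V, σ + τ, ⟨hU, hV⟩, ⟨hσ.isOpen.inter hτ.isOpen, ?_, ?_⟩, rfl, ?_⟩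
    · exact (hσ.smooth.mono Set.inter_subset_left).add (hτ.smooth.mono Set.inter_subset_right)
    · exact fun y hy => (S y).add_mem (hσ.mem y hy.1) (hτ.mem y hy.2)
    · have h1 := (hσ.smooth.contMDiffAt (hσ.isOpen.mem_nhds hU)).mdifferentiableAt (by simp)
      have h2 := (hτ.smooth.contMDiffAt (hτ.isOpen.mem_nhds hV)).mdifferentiableAt (by simp)
      simp only [dirDeriv] at hσX hτX ⊢
      rw [mfderiv_add h1 h2]
      exact (S x).add_mem hσX hτX
  smul_mem' := by
    rintro c v ⟨U, σ, hU, hσ, rfl, hσX⟩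
    refine ⟨U, c • σ, hU, ⟨hσ.isOpen, ?_, ?_⟩, rfl, ?_⟩
    · exact (c • ContinuousLinearMap.id ℝ R42).contMDiff.comp_contMDiffOn hσ.smooth
    · exact fun y hy => (S y).smul_mem c (hσ.mem y hy)
    · have h1 := (hσ.smooth.contMDiffAt (hσ.isOpen.mem_nhds hU)).mdifferentiableAt (by simp)
      simp only [dirDeriv] at hσX ⊢
      rw [const_smul_mfderiv h1]
      exact (S x).smul_mem c hσX

/-- The osculating sphere complex `L_i = ker 𝒩(T_i) ∩ S_i ∩ f^⊥`. -/
def osculatingComplex [IsManifold (𝓡 2) ∞ M] (f : M → Submodule ℝ R42)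
    (s : Fin 2 → M → Submodule ℝ R42) (i : Fin 2) (x : M) : Submodule ℝ R42 :=
  (⨅ X ∈ curvatureBundle f s i x, kerN (lieCyclide f s i) x X) ⊓
    lieCyclide f s i x ⊓ perp (f x)

/-! ### Gauge potentials and Calapso transforms -/

/-- A 1-form with values in the endomorphisms of `ℝ^{4,2}`. -/
abbrev EndForm (M : Type*) [TopologicalSpace M]
    [ChartedSpace (EuclideanSpace ℝ (Fin 2)) M] : Type _ :=
  (x : M) → TangentSpace (𝓡 2) x →L[ℝ] (R42 →L[ℝ] R42)

/-- The 1-form `η` in the chart at `c`. -/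
def coordForm (η : EndForm M) (c : M) (u : EuclideanSpace ℝ (Fin 2)) :
    EuclideanSpace ℝ (Fin 2) →L[ℝ] (R42 →L[ℝ] R42) :=
  (η ((extChartAt (𝓡 2) c).symm u)).comp
    (mfderiv 𝓘(ℝ, EuclideanSpace ℝ (Fin 2)) (𝓡 2) (extChartAt (𝓡 2) c).symm u)

/-- Smoothness of a 1-form. -/
def EndForm.IsSmooth (η : EndForm M) : Prop :=
  ∀ c : M, ContDiffOn ℝ ∞ (coordForm η c) (extChartAt (𝓡 2) c).target

/-- Closedness `dη = 0`, where `dη(a, b) = ∂_a (η(b)) - ∂_b (η(a))` in charts. -/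
def EndForm.IsClosed (η : EndForm M) : Prop :=
  ∀ c : M, ∀ u ∈ (extChartAt (𝓡 2) c).target, ∀ a b : EuclideanSpace ℝ (Fin 2),
    fderiv ℝ (coordForm η c) u a b = fderiv ℝ (coordForm η c) u b a

/-- `r` is the trace of the endomorphism `σ ↦ η(X) d_Y σ` of `f(x)`. -/
def IsQuadraticDifferential (f : M → Submodule ℝ R42) (η : EndForm M) (x : M)
    (X Y : TangentSpace (𝓡 2) x) (r : ℝ) : Prop :=
  ∃ A : f x →ₗ[ℝ] f x,
    (∀ (U : Set M) (σ : M → R42), IsSection f U σ → x ∈ U → ∀ hσ : σ x ∈ f x,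
      (A ⟨σ x, hσ⟩ : R42) = η x X (dirDeriv σ x Y)) ∧
    LinearMap.trace ℝ (f x) A = r

/-- `η` is a gauge potential of `f`; a Legendre map is Lie applicable when it has one. -/
structure IsGaugePotential (f : M → Submodule ℝ R42) (η : EndForm M) : Prop where
  smooth : η.IsSmooth
  mem : ∀ x X, η x X ∈ wedgeSpace (f x) (perp (f x))
  closed : η.IsClosed
  bracket : ∀ (x : M) (X Y : TangentSpace (𝓡 2) x),
    (η x X).comp (η x Y) - (η x Y).comp (η x X) = 0
  quadratic : ∃ (x : M) (X Y : TangentSpace (𝓡 2) x) (r : ℝ),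
    IsQuadraticDifferential f η x X Y r ∧ r ≠ 0

/-- `T` is a smooth map into the orthogonal group of `ℝ^{4,2}` with `T · (d + t η) = d`, i.e.
`d_X (T σ) = T (d_X σ + t η(X) σ)` for all smooth `σ`. -/
structure IsCalapsoGauge (η : EndForm M) (t : ℝ) (T : M → R42 →L[ℝ] R42) : Prop where
  smooth : ContMDiff (𝓡 2) 𝓘(ℝ, R42 →L[ℝ] R42) ∞ T
  orthogonal : ∀ (x : M) (v w : R42), form (T x v) (T x w) = form v w
  gauge : ∀ (U : Set M) (σ : M → R42), IsOpen U → ContMDiffOn (𝓡 2) 𝓘(ℝ, R42) ∞ σ U →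
    ∀ x ∈ U, ∀ X : TangentSpace (𝓡 2) x,
      dirDeriv (fun y => T y (σ y)) x X = T x (dirDeriv σ x X + t • η x X (σ x))

/-- The image `T f` of a subbundle. -/
def transform (T : M → R42 →L[ℝ] R42) (f : M → Submodule ℝ R42) : M → Submodule ℝ R42 :=
  fun x => (f x).map (T x : R42 →ₗ[ℝ] R42)

end LieSphere

end

open LieSphere

noncomputable section

namespace LieSphere

/-! ### Linear algebra in `ℝ^{4,2}` -/

/-! Write X and Y for local fields spanning `T_i` and the other curvature subbundle, and σ, τ for
sections spanning `s i` and the other curvature sphere. Thus d_Xσ and d_Yτ lie in f.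

The potential η takes values in f ∧ f^⊥, so it kills f and maps f^⊥ into f. Hence d(Tσ) = T dσ for
sections σ of f (`IsCalapsoGauge.dirDeriv_section`). All conditions that involve only first
derivatives of sections of f are therefore preserved: being Legendre, the curvature spheres, the
curvature subbundles and regularity.

The second ingredient is the flatness of d + tη, which is implied by the existence of T. It makes
tη(A)d_Bσ symmetric in A and B (`IsCalapsoGauge.smul_apply_dirDeriv_comm`), so that tη(X)d_Yσ =
tη(Y)d_Xσ = 0. Now f^⊥/f is positive definite of rank 2 with orthogonal basis d_Yσ, d_Xτ. So tη(X)
kills every vector of f^⊥ orthogonal to d_Xτ (`IsCalapsoGauge.smul_eq_zero_of_mem_perp`).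

Osculating complexes: in an adapted frame, `L_i` consists of those aσ + b d_Yσ for which a d_Xσ + b
d_Xd_Yσ lies in the span of σ and d_Yσ (`AdaptedFrame.mem_osculatingComplex_iff`). By the above, T
intertwines each of these vectors with its counterpart for Tσ.

Spherical curvature lines: they amount to a map κ into f^⊥ outside f with d_Xκ = 0, a condition free
of the conformal geometry (`isSphericalAlong_iff_hasParallelComplex`). Differentiating (τ, κ) = 0
along X gives (κ, d_Xτ) = 0, so tη(X)κ = 0, and Tκ is again constant along X
(`IsCalapsoGauge.hasParallelComplex_iff`). -/

lemma form_apply (v w : R42) :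
    form v w = v 0 * w 0 + v 1 * w 1 + v 2 * w 2 + v 3 * w 3 - v 4 * w 4 - v 5 * w 5 := by
  simp [form, Matrix.toBilin'_apply', dotProduct, Fin.sum_univ_succ, Matrix.mulVec_diagonal]
  ring

lemma form_comm (v w : R42) : form v w = form w v := by
  simp only [form_apply]; ring

lemma mem_perp {W : Submodule ℝ R42} {v : R42} : v ∈ perp W ↔ ∀ w ∈ W, form w v = 0 :=
  LinearMap.BilinForm.mem_orthogonal_iff

lemma mem_perp_span_singleton {p v : R42} :
    v ∈ perp (Submodule.span ℝ {p}) ↔ form p v = 0 := by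
  rw [mem_perp]
  constructor
  · exact fun h => h p (Submodule.mem_span_singleton_self p)
  · rintro h w hw
    obtain ⟨c, rfl⟩ := Submodule.mem_span_singleton.1 hw
    simp [h]

lemma form_self_eq_zero_of_null {W : Submodule ℝ R42} (hW : W ≤ perp W) {v w : R42}
    (hv : v ∈ W) (hw : w ∈ W) : form v w = 0 :=
  mem_perp.1 (hW hw) v hv

lemma eq_zero_of_form_eq_zero {v : R42} (h : ∀ w, form w v = 0) : v = 0 := by
  ext k
  have := h (Pi.single k 1)
  fin_cases k <;> simpa [form_apply] using this

/-- A null plane contains a vector with any prescribed negative coordinates. -/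
lemma exists_mem_null_plane {W : Submodule ℝ R42} (hW : W ≤ perp W)
    (h2 : Module.finrank ℝ W = 2) (v : R42) : ∃ w ∈ W, w 4 = v 4 ∧ w 5 = v 5 := by
  let A : W →ₗ[ℝ] ℝ × ℝ :=
    ((LinearMap.proj 4).prod (LinearMap.proj 5)).comp W.subtype
  -- A null vector with vanishing negative coordinates is zero, because the form is positive
  -- definite on the other four coordinates.
  have hA : Function.Injective A := by
    rw [injective_iff_map_eq_zero]
    intro w hw
    have h45 : (w : R42) 4 = 0 ∧ (w : R42) 5 = 0 := by simpa [A] using hw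
    have h0 := form_self_eq_zero_of_null hW w.2 w.2
    rw [form_apply, h45.1, h45.2] at h0
    have e0 : (w : R42) 0 = 0 := by nlinarith
    have e1 : (w : R42) 1 = 0 := by nlinarith
    have e2 : (w : R42) 2 = 0 := by nlinarith
    have e3 : (w : R42) 3 = 0 := by nlinarith
    ext k
    fin_cases k <;> simp [*]
  have hs : Function.Surjective A :=
    (LinearMap.injective_iff_surjective_of_finrank_eq_finrank (by simp [h2])).1 hA
  obtain ⟨w, hw⟩ := hs (v 4, v 5)
  exact ⟨w, w.2, by simpa [A] using hw⟩

/-- Subtract from v the vector w of W with the same negative coordinates. Since w is null and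
orthogonal to v, (v, v) = (v - w, v - w), which is a sum of four squares. This is the
semidefiniteness of W^⊥ with radical W. -/
lemma form_self_nonneg_of_mem_perp {W : Submodule ℝ R42} (hW : W ≤ perp W)
    (h2 : Module.finrank ℝ W = 2) {v : R42} (hv : v ∈ perp W) :
    0 ≤ form v v ∧ (form v v = 0 → v ∈ W) := by
  obtain ⟨w, hw, h4, h5⟩ := exists_mem_null_plane hW h2 v
  have hwv := mem_perp.1 hv w hw
  have hww := form_self_eq_zero_of_null hW hw hw
  rw [form_apply] at hwv hww
  rw [form_apply]
  rw [h4, h5] at hwv hww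
  have key : v 0 * v 0 + v 1 * v 1 + v 2 * v 2 + v 3 * v 3 - v 4 * v 4 - v 5 * v 5 =
      (v 0 - w 0) ^ 2 + (v 1 - w 1) ^ 2 + (v 2 - w 2) ^ 2 + (v 3 - w 3) ^ 2 := by
    linear_combination 2 * hwv - hww
  rw [key]
  refine ⟨by positivity, fun h => ?_⟩
  rw [add_eq_zero_iff_of_nonneg (by positivity) (by positivity),
    add_eq_zero_iff_of_nonneg (by positivity) (by positivity),
    add_eq_zero_iff_of_nonneg (by positivity) (by positivity)] at h
  simp only [sq_eq_zero_iff, sub_eq_zero] at h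
  obtain ⟨⟨⟨e0, e1⟩, e2⟩, e3⟩ := h
  have : v = w := by
    ext k
    fin_cases k <;> simp [*]
  exact this ▸ hw

lemma form_self_pos_of_mem_perp {W : Submodule ℝ R42} (hW : W ≤ perp W)
    (h2 : Module.finrank ℝ W = 2) {v : R42} (hv : v ∈ perp W) (hv' : v ∉ W) :
    0 < form v v := by
  obtain ⟨h, h'⟩ := form_self_nonneg_of_mem_perp hW h2 hv
  exact lt_of_le_of_ne h fun e => hv' (h' e.symm)

lemma exists_mem_form_ne_zero {W : Submodule ℝ R42} (hW : W ≤ perp W)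
    (h2 : Module.finrank ℝ W = 2) {p : R42} (hp : form p p < 0) : ∃ v ∈ W, form p v ≠ 0 := by
  by_contra! h
  have := (form_self_nonneg_of_mem_perp hW h2 (v := p)
    (mem_perp.2 fun w hw => by rw [form_comm]; exact h w hw)).1
  linarith

lemma finrank_perp (W : Submodule ℝ R42) :
    Module.finrank ℝ (perp W) = 6 - Module.finrank ℝ W := by
  have hr : form.IsRefl := fun v w h => by rwa [form_comm]
  have hn : form.Nondegenerate := by
    constructor
    · exact fun v h => eq_zero_of_form_eq_zero fun w => by rw [form_comm]; exact h w
    · exact fun v h => eq_zero_of_form_eq_zero h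
  have := LinearMap.BilinForm.finrank_orthogonal hn W
  rw [perp, this, Module.finrank_fintype_fun_eq_card, Fintype.card_fin]

/-- If `a`, `b` are orthogonal vectors of `W^⊥` that are not null, then every vector of `W^⊥`
orthogonal to `b` lies in the span of `W` and `a`. -/
lemma exists_sub_smul_mem {W : Submodule ℝ R42} (hW : W ≤ perp W)
    (h2 : Module.finrank ℝ W = 2) {a b v : R42} (ha : a ∈ perp W) (hb : b ∈ perp W)
    (haa : 0 < form a a) (hbb : 0 < form b b) (hab : form a b = 0) (hv : v ∈ perp W)
    (hvb : form v b = 0) : ∃ c : ℝ, v - c • a ∈ W := by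
  have hzero : ∀ p q : ℝ, p • a + q • b ∈ W → p = 0 ∧ q = 0 := by
    intro p q h
    have e1 := mem_perp.1 ha _ h
    have e2 := mem_perp.1 hb _ h
    have hba : form b a = 0 := by rw [form_comm, hab]
    simp only [map_add, map_smul, LinearMap.add_apply, LinearMap.smul_apply, smul_eq_mul, hab,
      hba, mul_zero, add_zero, zero_add, mul_eq_zero, haa.ne', hbb.ne', or_false] at e1 e2
    exact ⟨e1, e2⟩
  have hli : LinearIndependent ℝ ![a, b] :=
    LinearIndependent.pair_iff.2 fun p q h => hzero p q (h ▸ W.zero_mem)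
  have hdim : Module.finrank ℝ (Submodule.span ℝ {a, b}) = 2 := by
    have := finrank_span_eq_card hli
    rwa [Matrix.range_cons, Matrix.range_cons, Matrix.range_empty, Set.union_empty,
      Set.singleton_union, Fintype.card_fin] at this
  have hinf : W ⊓ Submodule.span ℝ {a, b} = ⊥ := by
    rw [eq_bot_iff]
    rintro w ⟨hw, hw'⟩
    obtain ⟨p, q, rfl⟩ := Submodule.mem_span_pair.1 hw'
    obtain ⟨rfl, rfl⟩ := hzero p q hw
    simp
  -- Both sides have dimension 4: 2 + 2 on the left, 6 - 2 on the right.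
  have hsup : W ⊔ Submodule.span ℝ {a, b} = perp W := by
    refine Submodule.eq_of_le_of_finrank_eq (sup_le hW ?_) ?_
    · rw [Submodule.span_le]
      rintro w (rfl | rfl)
      · exact ha
      · exact hb
    · have := Submodule.finrank_sup_add_finrank_inf_eq W (Submodule.span ℝ {a, b})
      rw [hinf, finrank_bot, h2, hdim] at this
      rw [finrank_perp, h2]
      omega
  rw [← hsup] at hv
  obtain ⟨w, hw, u, hu, rfl⟩ := Submodule.mem_sup.1 hv
  obtain ⟨p, q, rfl⟩ := Submodule.mem_span_pair.1 hu
  have hwb := mem_perp.1 hb w hw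
  have hq : q = 0 := by
    simp only [map_add, map_smul, LinearMap.add_apply, LinearMap.smul_apply, smul_eq_mul, hab,
      hwb, mul_zero, zero_add, mul_eq_zero, hbb.ne', or_false] at hvb
    exact hvb
  exact ⟨p, by simpa [hq] using hw⟩

lemma wedge_apply (a b c : R42) : wedge a b c = form a c • b - form b c • a := by
  simp [wedge]

/-- Both pairings in (a ∧ b)v vanish: (a, v) because W is null, (b, v) because b is orthogonal to W.
Applied to η, this lets the gauge commute with differentiation on sections of f. -/
lemma wedgeSpace_apply_eq_zero {W : Submodule ℝ R42} (hW : W ≤ perp W)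
    {A : R42 →L[ℝ] R42} (hA : A ∈ wedgeSpace W (perp W)) {v : R42} (hv : v ∈ W) : A v = 0 := by
  induction hA using Submodule.span_induction with
  | mem w h =>
    obtain ⟨a, ha, b, hb, rfl⟩ := h
    rw [wedge_apply, form_self_eq_zero_of_null hW ha hv, form_comm, mem_perp.1 hb v hv]
    simp
  | zero => simp
  | add A B _ _ hA hB => simp [hA, hB]
  | smul c A _ hA => simp [hA]

lemma wedgeSpace_apply_mem {W : Submodule ℝ R42}
    {A : R42 →L[ℝ] R42} (hA : A ∈ wedgeSpace W (perp W)) {v : R42} (hv : v ∈ perp W) :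
    A v ∈ W := by
  induction hA using Submodule.span_induction with
  | mem w h =>
    obtain ⟨a, ha, b, hb, rfl⟩ := h
    rw [wedge_apply, mem_perp.1 hv a ha, zero_smul, zero_sub]
    exact W.neg_mem (W.smul_mem _ ha)
  | zero => simp
  | add A B _ _ hA hB => exact W.add_mem hA hB
  | smul c A _ hA => exact W.smul_mem c hA

/-! ### Calculus for maps from a surface to a vector space -/

variable {M : Type*} [TopologicalSpace M] [ChartedSpace (EuclideanSpace ℝ (Fin 2)) M]
variable {F : Type*} [NormedAddCommGroup F] [NormedSpace ℝ F]

lemma mdifferentiableAt_iff_chart {g : M → F} {x : M} (hc : ContinuousAt g x) :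
    MDifferentiableAt (𝓡 2) 𝓘(ℝ, F) g x ↔
      DifferentiableAt ℝ (g ∘ (extChartAt (𝓡 2) x).symm) (extChartAt (𝓡 2) x x) := by
  rw [mdifferentiableAt_iff]
  simp only [hc, true_and, writtenInExtChartAt, modelWithCornersSelf_coe, Set.range_id,
    differentiableWithinAt_univ]
  rfl

lemma mdifferentiableAt_chart {g : M → F} {x : M}
    (h : MDifferentiableAt (𝓡 2) 𝓘(ℝ, F) g x) :
    DifferentiableAt ℝ (g ∘ (extChartAt (𝓡 2) x).symm) (extChartAt (𝓡 2) x x) :=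
  (mdifferentiableAt_iff_chart h.continuousAt).1 h

lemma mfderiv_eq_fderiv_chart {g : M → F} {x : M} (h : MDifferentiableAt (𝓡 2) 𝓘(ℝ, F) g x) :
    mfderiv (𝓡 2) 𝓘(ℝ, F) g x =
      fderiv ℝ (g ∘ (extChartAt (𝓡 2) x).symm) (extChartAt (𝓡 2) x x) := by
  rw [h.mfderiv]
  simp only [writtenInExtChartAt, modelWithCornersSelf_coe, Set.range_id, fderivWithin_univ]
  rfl

lemma eventually_chart {x : M} {P : M → Prop} (h : ∀ᶠ y in 𝓝 x, P y) :
    ∀ᶠ u in 𝓝 (extChartAt (𝓡 2) x x), P ((extChartAt (𝓡 2) x).symm u) := by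
  have := (continuousAt_extChartAt_symm (I := 𝓡 2) x).tendsto
  rw [extChartAt_to_inv] at this
  exact this.eventually h

/-- A section of the span of a frame that vanishes at a point has its derivative at this point
in the span. -/
lemma fderiv_mem_span_of_eq_zero {E : Type*} [NormedAddCommGroup E] [NormedSpace ℝ E] {k : ℕ}
    {e : Fin k → E → R42} {ρ : E → R42} {u : E} (he : ∀ j, DifferentiableAt ℝ (e j) u)
    (hli : LinearIndependent ℝ fun j => e j u) (hρ : DifferentiableAt ℝ ρ u)
    (hmem : ∀ᶠ z in 𝓝 u, ρ z ∈ Submodule.span ℝ (Set.range fun j => e j z)) (h0 : ρ u = 0)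
    (a : E) : fderiv ℝ ρ u a ∈ Submodule.span ℝ (Set.range fun j => e j u) := by
  let V := Fin k → ℝ
  let Ψ : E → V →L[ℝ] R42 := fun z =>
    ∑ j, (ContinuousLinearMap.proj (R := ℝ) (φ := fun _ : Fin k => ℝ) j).smulRight (e j z)
  have hΨ : ∀ z c, Ψ z c = ∑ j, c j • e j z := fun z c => by
    simp only [Ψ, sum_apply, ContinuousLinearMap.smulRight_apply]
    rfl
  have hΨd : DifferentiableAt ℝ Ψ u := by
    refine DifferentiableAt.fun_sum fun j _ => ?_
    exact ((ContinuousLinearMap.smulRightL ℝ V R42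
      (ContinuousLinearMap.proj (R := ℝ) (φ := fun _ : Fin k => ℝ) j)).differentiableAt).comp u
      (he j)
  have hinj : Function.Injective (Ψ u : V →ₗ[ℝ] R42) := by
    rw [injective_iff_map_eq_zero]
    intro c hc
    have := Fintype.linearIndependent_iff.1 hli c (by rw [← hΨ]; exact hc)
    exact funext this
  obtain ⟨A, hA⟩ := LinearMap.exists_leftInverse_of_injective (Ψ u : V →ₗ[ℝ] R42)
    (LinearMap.ker_eq_bot.2 hinj)
  let A' : R42 →L[ℝ] V := LinearMap.toContinuousLinearMap A
  have hAu : A'.comp (Ψ u) = 1 := by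
    ext1 c
    exact LinearMap.congr_fun hA c
  -- A left inverse of the frame map at u stays invertible on the frame near u, so the coefficients
  -- of ρ are recovered by a differentiable formula `c`.
  let G : E → V →L[ℝ] V := fun z => A'.comp (Ψ z)
  have hG : DifferentiableAt ℝ G u := (differentiableAt_const A').clm_comp hΨd
  have hGu : G u = 1 := hAu
  have hGunit : IsUnit (G u) := hGu ▸ isUnit_one
  let c : E → V := fun z => Ring.inverse (G z) (A' (ρ z))
  have hc : DifferentiableAt ℝ c u :=
    ((differentiableAt_inverse hGunit).comp u hG).clm_apply
      (A'.differentiableAt.comp u hρ)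
  have hev : ∀ᶠ z in 𝓝 u, ρ z = Ψ z (c z) := by
    have h1 : ∀ᶠ z in 𝓝 u, IsUnit (G z) :=
      hG.continuousAt.eventually (Units.isOpen.mem_nhds hGunit)
    filter_upwards [h1, hmem] with z hz hzm
    obtain ⟨d, hd⟩ := (Submodule.mem_span_range_iff_exists_fun ℝ).1 hzm
    have hd' : ρ z = Ψ z d := by rw [hΨ, hd]
    have : c z = d := by
      have h2 : A' (ρ z) = G z d := by rw [hd']; rfl
      change Ring.inverse (G z) (A' (ρ z)) = d
      rw [h2]
      exact congrArg (fun L : V →L[ℝ] V => L d) (Ring.inverse_mul_cancel _ hz)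
    rw [this, hd']
  have hcu : c u = 0 := by simp [c, h0]
  -- In the product rule, the term with the derivative of the frame drops out because the
  -- coefficients vanish at u.
  have hd : fderiv ℝ ρ u a = Ψ u (fderiv ℝ c u a) := by
    rw [Filter.EventuallyEq.fderiv_eq hev, fderiv_clm_apply hΨd hc]
    simp [hcu]
  rw [hd, hΨ]
  exact Submodule.sum_mem _ fun j _ =>
    Submodule.smul_mem _ _ (Submodule.subset_span (Set.mem_range_self j))

lemma dirDeriv_eq_fderiv {σ : M → R42} {x : M} (h : MDifferentiableAt (𝓡 2) 𝓘(ℝ, R42) σ x)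
    (X : TangentSpace (𝓡 2) x) :
    dirDeriv σ x X =
      fderiv ℝ (σ ∘ (extChartAt (𝓡 2) x).symm) (extChartAt (𝓡 2) x x) X := by
  rw [dirDeriv, mfderiv_eq_fderiv_chart h]
  rfl

lemma dirDeriv_mem_span_of_eq_zero {k : ℕ} {e : Fin k → M → R42} {ρ : M → R42} {x : M}
    (he : ∀ j, MDifferentiableAt (𝓡 2) 𝓘(ℝ, R42) (e j) x)
    (hli : LinearIndependent ℝ fun j => e j x) (hρ : MDifferentiableAt (𝓡 2) 𝓘(ℝ, R42) ρ x)
    (hmem : ∀ᶠ y in 𝓝 x, ρ y ∈ Submodule.span ℝ (Set.range fun j => e j y)) (h0 : ρ x = 0)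
    (X : TangentSpace (𝓡 2) x) :
    dirDeriv ρ x X ∈ Submodule.span ℝ (Set.range fun j => e j x) := by
  rw [dirDeriv_eq_fderiv hρ]
  have := fderiv_mem_span_of_eq_zero (fun j => mdifferentiableAt_chart (he j))
    (by simpa using hli) (mdifferentiableAt_chart hρ) (eventually_chart hmem)
    (by simpa using h0) X
  simpa using this

lemma dirDeriv_congr {σ τ : M → R42} {x : M} (h : σ =ᶠ[𝓝 x] τ) (X : TangentSpace (𝓡 2) x) :
    dirDeriv σ x X = dirDeriv τ x X := by
  simp only [dirDeriv]
  rw [h.mfderiv_eq]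
  rfl

lemma dirDeriv_const (v : R42) (x : M) (X : TangentSpace (𝓡 2) x) :
    dirDeriv (fun _ => v) x X = 0 := by
  rw [dirDeriv, mfderiv_const]
  rfl

lemma dirDeriv_add {σ τ : M → R42} {x : M} (hσ : MDifferentiableAt (𝓡 2) 𝓘(ℝ, R42) σ x)
    (hτ : MDifferentiableAt (𝓡 2) 𝓘(ℝ, R42) τ x) (X : TangentSpace (𝓡 2) x) :
    dirDeriv (fun y => σ y + τ y) x X = dirDeriv σ x X + dirDeriv τ x X := by
  have := mfderiv_add hσ hτ
  exact congrArg (fun L => L X) this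

lemma dirDeriv_sub {σ τ : M → R42} {x : M} (hσ : MDifferentiableAt (𝓡 2) 𝓘(ℝ, R42) σ x)
    (hτ : MDifferentiableAt (𝓡 2) 𝓘(ℝ, R42) τ x) (X : TangentSpace (𝓡 2) x) :
    dirDeriv (fun y => σ y - τ y) x X = dirDeriv σ x X - dirDeriv τ x X := by
  have := mfderiv_sub hσ hτ
  exact congrArg (fun L => L X) this

/-- The directional derivative of a function. -/
def dirDerivReal (h : M → ℝ) (x : M) (X : TangentSpace (𝓡 2) x) : ℝ :=
  mfderiv (𝓡 2) 𝓘(ℝ, ℝ) h x X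

lemma dirDerivReal_eq_fderiv {h : M → ℝ} {x : M} (hh : MDifferentiableAt (𝓡 2) 𝓘(ℝ, ℝ) h x)
    (X : TangentSpace (𝓡 2) x) :
    dirDerivReal h x X =
      fderiv ℝ (h ∘ (extChartAt (𝓡 2) x).symm) (extChartAt (𝓡 2) x x) X := by
  rw [dirDerivReal, mfderiv_eq_fderiv_chart hh]
  rfl

lemma dirDerivReal_const (c : ℝ) (x : M) (X : TangentSpace (𝓡 2) x) :
    dirDerivReal (fun _ => c) x X = 0 := by
  rw [dirDerivReal, mfderiv_const]
  rfl

lemma dirDerivReal_congr {g h : M → ℝ} {x : M} (e : g =ᶠ[𝓝 x] h) (X : TangentSpace (𝓡 2) x) :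
    dirDerivReal g x X = dirDerivReal h x X := by
  simp only [dirDerivReal]
  rw [e.mfderiv_eq]
  rfl

lemma dirDeriv_smul {h : M → ℝ} {σ : M → R42} {x : M}
    (hh : MDifferentiableAt (𝓡 2) 𝓘(ℝ, ℝ) h x)
    (hσ : MDifferentiableAt (𝓡 2) 𝓘(ℝ, R42) σ x) (X : TangentSpace (𝓡 2) x) :
    dirDeriv (fun y => h y • σ y) x X = h x • dirDeriv σ x X + dirDerivReal h x X • σ x := by
  have hs : MDifferentiableAt (𝓡 2) 𝓘(ℝ, R42) (fun y => h y • σ y) x := hh.smul hσ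
  rw [dirDeriv_eq_fderiv hs, dirDeriv_eq_fderiv hσ, dirDerivReal_eq_fderiv hh]
  have h2 := congrArg (fun L => L X)
    (fderiv_fun_smul (mdifferentiableAt_chart hh) (mdifferentiableAt_chart hσ))
  refine h2.trans ?_
  simp only [Function.comp_apply, extChartAt_to_inv]
  rfl

lemma dirDeriv_const_smul (c : ℝ) {σ : M → R42} {x : M}
    (hσ : MDifferentiableAt (𝓡 2) 𝓘(ℝ, R42) σ x) (X : TangentSpace (𝓡 2) x) :
    dirDeriv (fun y => c • σ y) x X = c • dirDeriv σ x X := by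
  have := dirDeriv_smul (h := fun _ => c) mdifferentiableAt_const hσ X
  rw [this, dirDerivReal_const, zero_smul, add_zero]

lemma dirDeriv_smul_add_smul {σ τ : M → R42} {x : M} (a b : ℝ)
    (hσ : MDifferentiableAt (𝓡 2) 𝓘(ℝ, R42) σ x) (hτ : MDifferentiableAt (𝓡 2) 𝓘(ℝ, R42) τ x)
    (X : TangentSpace (𝓡 2) x) :
    dirDeriv (fun y => a • σ y + b • τ y) x X = a • dirDeriv σ x X + b • dirDeriv τ x X :=
  (dirDeriv_add (hσ.const_smul a) (hτ.const_smul b) X).trans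
    (congrArg₂ (· + ·) (dirDeriv_const_smul a hσ X) (dirDeriv_const_smul b hτ X))

/-- The bilinear form as a continuous bilinear map. -/
def formL : R42 →L[ℝ] R42 →L[ℝ] ℝ := LinearMap.toContinuousBilinearMap form

lemma mdifferentiableAt_form {σ τ : M → R42} {x : M}
    (hσ : MDifferentiableAt (𝓡 2) 𝓘(ℝ, R42) σ x) (hτ : MDifferentiableAt (𝓡 2) 𝓘(ℝ, R42) τ x) :
    MDifferentiableAt (𝓡 2) 𝓘(ℝ, ℝ) (fun y => form (σ y) (τ y)) x := by
  have h1 : MDifferentiableAt (𝓡 2) 𝓘(ℝ, R42 →L[ℝ] ℝ) (fun y => formL (σ y)) x :=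
    formL.mdifferentiableAt.comp x hσ
  exact h1.clm_apply hτ

lemma contMDiffOn_form {σ τ : M → R42} {U : Set M}
    (hσ : ContMDiffOn (𝓡 2) 𝓘(ℝ, R42) ∞ σ U) (hτ : ContMDiffOn (𝓡 2) 𝓘(ℝ, R42) ∞ τ U) :
    ContMDiffOn (𝓡 2) 𝓘(ℝ, ℝ) ∞ (fun y => form (σ y) (τ y)) U := by
  have h1 : ContMDiffOn (𝓡 2) 𝓘(ℝ, R42 →L[ℝ] ℝ) ∞ (fun y => formL (σ y)) U :=
    formL.contMDiff.comp_contMDiffOn hσ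
  exact h1.clm_apply hτ

lemma dirDerivReal_form {σ τ : M → R42} {x : M}
    (hσ : MDifferentiableAt (𝓡 2) 𝓘(ℝ, R42) σ x) (hτ : MDifferentiableAt (𝓡 2) 𝓘(ℝ, R42) τ x)
    (X : TangentSpace (𝓡 2) x) :
    dirDerivReal (fun y => form (σ y) (τ y)) x X =
      form (dirDeriv σ x X) (τ x) + form (σ x) (dirDeriv τ x X) := by
  rw [dirDerivReal_eq_fderiv (mdifferentiableAt_form hσ hτ), dirDeriv_eq_fderiv hσ,
    dirDeriv_eq_fderiv hτ]
  have h1 : DifferentiableAt ℝ (fun u => formL ((σ ∘ (extChartAt (𝓡 2) x).symm) u))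
      (extChartAt (𝓡 2) x x) :=
    formL.differentiableAt.comp _ (mdifferentiableAt_chart hσ)
  have h2 := congrArg (fun L => L X) (fderiv_clm_apply h1 (mdifferentiableAt_chart hτ))
  refine h2.trans ?_
  have h3 := fderiv_comp (extChartAt (𝓡 2) x x) formL.differentiableAt
    (mdifferentiableAt_chart hσ)
  rw [ContinuousLinearMap.fderiv] at h3
  have h4 : fderiv ℝ (fun u => formL ((σ ∘ (extChartAt (𝓡 2) x).symm) u))
      (extChartAt (𝓡 2) x x) = _ := h3
  rw [h4]
  simp only [Function.comp_apply, extChartAt_to_inv]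
  exact add_comm _ _

lemma form_dirDeriv_add_eq_zero {σ τ : M → R42} {x : M} {c : ℝ}
    (hσ : MDifferentiableAt (𝓡 2) 𝓘(ℝ, R42) σ x) (hτ : MDifferentiableAt (𝓡 2) 𝓘(ℝ, R42) τ x)
    (h : ∀ᶠ y in 𝓝 x, form (σ y) (τ y) = c) (X : TangentSpace (𝓡 2) x) :
    form (dirDeriv σ x X) (τ x) + form (σ x) (dirDeriv τ x X) = 0 := by
  rw [← dirDerivReal_form hσ hτ, dirDerivReal_congr h, dirDerivReal_const]

end LieSphere
end

noncomputable section

namespace LieSphere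

variable {M : Type*} [TopologicalSpace M] [ChartedSpace (EuclideanSpace ℝ (Fin 2)) M]

/-! ### Sections and frames -/

lemma IsSection.mdifferentiableAt {f : M → Submodule ℝ R42} {U : Set M} {σ : M → R42}
    (h : IsSection f U σ) {x : M} (hx : x ∈ U) : MDifferentiableAt (𝓡 2) 𝓘(ℝ, R42) σ x :=
  (h.smooth.contMDiffAt (h.isOpen.mem_nhds hx)).mdifferentiableAt (by simp)

lemma IsSection.mono {f g : M → Submodule ℝ R42} {U V : Set M} {σ : M → R42}
    (h : IsSection f U σ) (hV : IsOpen V) (hVU : V ⊆ U) (hfg : ∀ y ∈ V, f y ≤ g y) :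
    IsSection g V σ :=
  ⟨hV, h.smooth.mono hVU, fun y hy => hfg y hy (h.mem y (hVU hy))⟩

lemma contMDiffOn_const_smul {F : Type*} [NormedAddCommGroup F] [NormedSpace ℝ F] {U : Set M}
    {σ : M → F} (c : ℝ) (h : ContMDiffOn (𝓡 2) 𝓘(ℝ, F) ∞ σ U) :
    ContMDiffOn (𝓡 2) 𝓘(ℝ, F) ∞ (fun y => c • σ y) U := by
  have h0 : ContMDiffOn (𝓡 2) 𝓘(ℝ, ℝ) ∞ (fun _ : M => c) U := contMDiffOn_const
  exact h0.smul h

lemma IsSection.const_smul {f : M → Submodule ℝ R42} {U : Set M} {σ : M → R42} (c : ℝ)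
    (h : IsSection f U σ) : IsSection f U (fun y => c • σ y) :=
  ⟨h.isOpen, contMDiffOn_const_smul c h.smooth, fun y hy => (f y).smul_mem c (h.mem y hy)⟩

lemma IsSection.add {f : M → Submodule ℝ R42} {U : Set M} {σ τ : M → R42}
    (h : IsSection f U σ) (h' : IsSection f U τ) : IsSection f U (fun y => σ y + τ y) :=
  ⟨h.isOpen, h.smooth.add h'.smooth, fun y hy => (f y).add_mem (h.mem y hy) (h'.mem y hy)⟩

lemma mdifferentiableAt_of_contMDiffOn {F : Type*} [NormedAddCommGroup F] [NormedSpace ℝ F]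
    {U : Set M} {σ : M → F} (h : ContMDiffOn (𝓡 2) 𝓘(ℝ, F) ∞ σ U) (hU : IsOpen U) {x : M}
    (hx : x ∈ U) : MDifferentiableAt (𝓡 2) 𝓘(ℝ, F) σ x :=
  (h.contMDiffAt (hU.mem_nhds hx)).mdifferentiableAt (by simp)

/-- If a section of the span of a frame agrees at a point with a constant linear combination of
the frame, then their derivatives differ by an element of the span. -/
lemma dirDeriv_sub_mem_span {k : ℕ} {e : Fin k → M → R42} {ρ : M → R42} {x : M}
    (he : ∀ j, MDifferentiableAt (𝓡 2) 𝓘(ℝ, R42) (e j) x)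
    (hli : LinearIndependent ℝ fun j => e j x) (hρ : MDifferentiableAt (𝓡 2) 𝓘(ℝ, R42) ρ x)
    (hmem : ∀ᶠ y in 𝓝 x, ρ y ∈ Submodule.span ℝ (Set.range fun j => e j y))
    {τ : M → R42} (hτ : MDifferentiableAt (𝓡 2) 𝓘(ℝ, R42) τ x)
    (hτmem : ∀ᶠ y in 𝓝 x, τ y ∈ Submodule.span ℝ (Set.range fun j => e j y))
    (h : ρ x = τ x) (X : TangentSpace (𝓡 2) x) :
    dirDeriv ρ x X - dirDeriv τ x X ∈ Submodule.span ℝ (Set.range fun j => e j x) := by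
  rw [← dirDeriv_sub hρ hτ]
  refine dirDeriv_mem_span_of_eq_zero he hli (hρ.sub hτ) ?_ (sub_eq_zero.2 h) X
  filter_upwards [hmem, hτmem] with y h1 h2 using Submodule.sub_mem _ h1 h2

/-- Two sections of a subbundle with the same value at a point have derivatives that agree up to
the subbundle. -/
lemma IsSubbundle.dirDeriv_sub_mem {k : ℕ} {f : M → Submodule ℝ R42}
    (hf : IsSubbundle (k + 1) f)
    {U V : Set M} {σ τ : M → R42} (hσ : IsSection f U σ) (hτ : IsSection f V τ) {x : M}
    (hx : x ∈ U) (hx' : x ∈ V) (h : σ x = τ x) (X : TangentSpace (𝓡 2) x) :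
    dirDeriv σ x X - dirDeriv τ x X ∈ f x := by
  obtain ⟨W, e, hW, he, hfr⟩ := hf x
  rw [← (hfr x hW).2]
  -- The openness of W is recorded only in the members of the frame, which is why the rank has the
  -- form k + 1.
  have hWx : W ∈ 𝓝 x := (he 0).isOpen.mem_nhds hW
  refine dirDeriv_sub_mem_span (fun j => (he j).mdifferentiableAt hW) (hfr x hW).1
    (hσ.mdifferentiableAt hx) ?_ (hτ.mdifferentiableAt hx') ?_ h X
  · filter_upwards [hWx, hσ.isOpen.mem_nhds hx] with y hy hyU
    rw [(hfr y hy).2]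
    exact hσ.mem y hyU
  · filter_upwards [hWx, hτ.isOpen.mem_nhds hx'] with y hy hyU
    rw [(hfr y hy).2]
    exact hτ.mem y hyU

lemma IsSubbundle.finrank_eq {k : ℕ} {f : M → Submodule ℝ R42} (hf : IsSubbundle k f) (x : M) :
    Module.finrank ℝ (f x) = k := by
  obtain ⟨W, e, hW, -, hfr⟩ := hf x
  rw [← (hfr x hW).2, finrank_span_eq_card (hfr x hW).1, Fintype.card_fin]

/-- A line bundle has a nowhere zero local section around every point. -/
lemma IsSubbundle.exists_frame_one {f : M → Submodule ℝ R42} (hf : IsSubbundle 1 f) (x : M) :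
    ∃ (U : Set M) (σ : M → R42), x ∈ U ∧ IsSection f U σ ∧
      ∀ y ∈ U, σ y ≠ 0 ∧ f y = Submodule.span ℝ {σ y} := by
  obtain ⟨U, e, hU, he, hfr⟩ := hf x
  refine ⟨U, e 0, hU, he 0, fun y hy => ⟨(hfr y hy).1.ne_zero 0, ?_⟩⟩
  rw [← (hfr y hy).2]
  congr 1
  ext v
  simp [eq_comm]

/-- Every vector of a subbundle extends to a local section. -/
lemma IsSubbundle.exists_section {k : ℕ} {f : M → Submodule ℝ R42} (hf : IsSubbundle (k + 1) f)
    {x : M} {v : R42} (hv : v ∈ f x) :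
    ∃ (U : Set M) (σ : M → R42), x ∈ U ∧ IsSection f U σ ∧ σ x = v := by
  obtain ⟨U, e, hU, he, hfr⟩ := hf x
  rw [← (hfr x hU).2] at hv
  obtain ⟨c, rfl⟩ := (Submodule.mem_span_range_iff_exists_fun ℝ).1 hv
  refine ⟨U, fun y => ∑ j, c j • e j y, hU, ⟨(he 0).isOpen, ?_, fun y hy => ?_⟩, rfl⟩
  · exact contMDiffOn_finsetSum fun j _ => contMDiffOn_const_smul (c j) (he j).smooth
  · exact Submodule.sum_mem _ fun j _ => Submodule.smul_mem _ _ ((he j).mem y hy)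

/-! ### Coordinate vector fields -/

/-- The vector field with constant coordinates `a` in the chart at `x`. -/
def coordField (x : M) (a : EuclideanSpace ℝ (Fin 2)) (y : M) : TangentSpace (𝓡 2) y :=
  mfderiv 𝓘(ℝ, EuclideanSpace ℝ (Fin 2)) (𝓡 2) (extChartAt (𝓡 2) x).symm
    (extChartAt (𝓡 2) x y) a

lemma coordField_add (x : M) (a b : EuclideanSpace ℝ (Fin 2)) (y : M) :
    coordField x (a + b) y = coordField x a y + coordField x b y :=
  map_add _ _ _

lemma coordField_smul (x : M) (c : ℝ) (a : EuclideanSpace ℝ (Fin 2)) (y : M) :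
    coordField x (c • a) y = c • coordField x a y :=
  map_smul _ _ _

variable [IsManifold (𝓡 2) ∞ M]

lemma isManifold_one : IsManifold (𝓡 2) 1 M := IsManifold.of_le (n := ∞) (by simp)

lemma coordField_eq_symmL {x y : M} (hy : y ∈ (chartAt (EuclideanSpace ℝ (Fin 2)) x).source)
    (a : EuclideanSpace ℝ (Fin 2)) :
    haveI := isManifold_one (M := M)
    coordField x a y = (trivializationAt (EuclideanSpace ℝ (Fin 2))
      (TangentSpace (𝓡 2) : M → Type _) x).symmL ℝ y a := by
  have := isManifold_one (M := M)
  rw [TangentBundle.symmL_trivializationAt hy]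
  simp only [modelWithCornersSelf_coe, Set.range_id, mfderivWithin_univ]
  rfl

lemma exists_coordField_eq {x y : M}
    (hy : y ∈ (chartAt (EuclideanSpace ℝ (Fin 2)) x).source) (X : TangentSpace (𝓡 2) y) :
    ∃ a, coordField x a y = X := by
  have := isManifold_one (M := M)
  refine ⟨(trivializationAt (EuclideanSpace ℝ (Fin 2))
      (TangentSpace (𝓡 2) : M → Type _) x).continuousLinearMapAt ℝ y X, ?_⟩
  rw [coordField_eq_symmL hy]
  exact Bundle.Trivialization.symmL_continuousLinearMapAt _ (by simpa using hy) X

lemma coordField_injective {x y : M}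
    (hy : y ∈ (chartAt (EuclideanSpace ℝ (Fin 2)) x).source)
    {a : EuclideanSpace ℝ (Fin 2)} (h : coordField x a y = 0) : a = 0 := by
  have := isManifold_one (M := M)
  rw [coordField_eq_symmL hy] at h
  rw [← Bundle.Trivialization.continuousLinearMapAt_symmL (R := ℝ)
    (trivializationAt (EuclideanSpace ℝ (Fin 2))
      (TangentSpace (𝓡 2) : M → Type _) x) (b := y) (by simpa using hy) a, h, map_zero]

lemma contMDiffOn_coordField (x : M) (a : EuclideanSpace ℝ (Fin 2)) :
    ContMDiffOn (𝓡 2) (𝓡 2).tangent ∞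
      (fun y => (⟨y, coordField x a y⟩ : TangentBundle (𝓡 2) M))
      (chartAt (EuclideanSpace ℝ (Fin 2)) x).source := by
  have := isManifold_one (M := M)
  set e := trivializationAt (EuclideanSpace ℝ (Fin 2)) (TangentSpace (𝓡 2) : M → Type _) x
    with he
  have hb : e.baseSet = (chartAt (EuclideanSpace ℝ (Fin 2)) x).source := by simp [he]
  rw [← hb, e.contMDiffOn_section_baseSet_iff]
  refine (contMDiffOn_const (c := a)).congr fun y hy => ?_
  rw [coordField_eq_symmL (hb ▸ hy), Bundle.Trivialization.symmL_apply _ hy]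
  rw [e.apply_mk_symm hy]

/-- The derivative of a smooth map along a smooth vector field is smooth. -/
lemma contMDiffOn_dirDeriv {σ : M → R42} {Y : (y : M) → TangentSpace (𝓡 2) y} {U : Set M}
    (hU : IsOpen U) (hσ : ContMDiffOn (𝓡 2) 𝓘(ℝ, R42) ∞ σ U)
    (hY : ContMDiffOn (𝓡 2) (𝓡 2).tangent ∞
      (fun y => (⟨y, Y y⟩ : TangentBundle (𝓡 2) M)) U) :
    ContMDiffOn (𝓡 2) 𝓘(ℝ, R42) ∞ (fun y => dirDeriv σ y (Y y)) U := by
  have := isManifold_one (M := M)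
  have h1 := hσ.contMDiffOn_tangentMapWithin (m := ∞) le_rfl hU.uniqueMDiffOn
  have h2 := h1.comp hY (fun y hy => hy)
  have h3 := (contMDiff_snd_tangentBundle_modelSpace (n := ∞) R42
    𝓘(ℝ, R42)).comp_contMDiffOn h2
  refine h3.congr fun y hy => ?_
  change dirDeriv σ y (Y y) = mfderivWithin (𝓡 2) 𝓘(ℝ, R42) σ U y (Y y)
  rw [mfderivWithin_of_isOpen hU hy]
  rfl

lemma dirDeriv_coordField {σ : M → R42} {x y : M}
    (hy : y ∈ (chartAt (EuclideanSpace ℝ (Fin 2)) x).source)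
    (hσ : MDifferentiableAt (𝓡 2) 𝓘(ℝ, R42) σ y) (a : EuclideanSpace ℝ (Fin 2)) :
    dirDeriv σ y (coordField x a y) =
      fderiv ℝ (σ ∘ (extChartAt (𝓡 2) x).symm) (extChartAt (𝓡 2) x y) a := by
  have hy' : y ∈ (extChartAt (𝓡 2) x).source := by rwa [extChartAt_source]
  have hu : extChartAt (𝓡 2) x y ∈ (extChartAt (𝓡 2) x).target :=
    (extChartAt (𝓡 2) x).map_source hy'
  have hl : (extChartAt (𝓡 2) x).symm (extChartAt (𝓡 2) x y) = y :=
    (extChartAt (𝓡 2) x).left_inv hy'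
  have h1 : MDifferentiableAt 𝓘(ℝ, EuclideanSpace ℝ (Fin 2)) (𝓡 2)
      (extChartAt (𝓡 2) x).symm (extChartAt (𝓡 2) x y) :=
    ((contMDiffOn_extChartAt_symm (n := ∞) x).contMDiffAt
      ((isOpen_extChartAt_target x).mem_nhds hu)).mdifferentiableAt (by simp)
  have h2 : MDifferentiableAt (𝓡 2) 𝓘(ℝ, R42) σ
      ((extChartAt (𝓡 2) x).symm (extChartAt (𝓡 2) x y)) := by rwa [hl]
  have h3 := mfderiv_comp (extChartAt (𝓡 2) x y) h2 h1
  rw [mfderiv_eq_fderiv] at h3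
  rw [h3, dirDeriv, coordField]
  change _ = mfderiv (𝓡 2) 𝓘(ℝ, R42) σ
      ((extChartAt (𝓡 2) x).symm (extChartAt (𝓡 2) x y)) _
  rw [hl]
  rfl

/-- Second derivatives along coordinate fields are symmetric. -/
lemma dirDeriv_coordField_comm {σ : M → R42} {x : M} {U : Set M} (hU : IsOpen U) (hx : x ∈ U)
    (hσ : ContMDiffOn (𝓡 2) 𝓘(ℝ, R42) ∞ σ U) (a b : EuclideanSpace ℝ (Fin 2)) :
    dirDeriv (fun y => dirDeriv σ y (coordField x a y)) x (coordField x b x) =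
      dirDeriv (fun y => dirDeriv σ y (coordField x b y)) x (coordField x a x) := by
  have hxs := mem_chart_source (EuclideanSpace ℝ (Fin 2)) x
  have hσx : ContMDiffAt (𝓡 2) 𝓘(ℝ, R42) ∞ σ
      ((extChartAt (𝓡 2) x).symm (extChartAt (𝓡 2) x x)) := by
    rw [extChartAt_to_inv]
    exact hσ.contMDiffAt (hU.mem_nhds hx)
  have hs : ContDiffAt ℝ ∞ (σ ∘ (extChartAt (𝓡 2) x).symm) (extChartAt (𝓡 2) x x) :=
    contMDiffAt_iff_contDiffAt.1 (hσx.comp _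
      ((contMDiffOn_extChartAt_symm (n := ∞) x).contMDiffAt
        (extChartAt_target_mem_nhds x)))
  have hd : DifferentiableAt ℝ (fderiv ℝ (σ ∘ (extChartAt (𝓡 2) x).symm))
      (extChartAt (𝓡 2) x x) :=
    (hs.fderiv_right (m := 1) (WithTop.coe_le_coe.2 le_top)).differentiableAt (by simp)
  have hsrc := (chartAt (EuclideanSpace ℝ (Fin 2)) x).open_source
  -- Coordinate fields are constant in the chart, so the iterated derivative is the second Fréchet
  -- derivative there, with no first-order correction.
  have key : ∀ c d : EuclideanSpace ℝ (Fin 2),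
      dirDeriv (fun y => dirDeriv σ y (coordField x c y)) x (coordField x d x) =
        fderiv ℝ (fderiv ℝ (σ ∘ (extChartAt (𝓡 2) x).symm)) (extChartAt (𝓡 2) x x) d c := by
    intro c d
    have hg := contMDiffOn_dirDeriv (hU.inter hsrc) (hσ.mono Set.inter_subset_left)
      ((contMDiffOn_coordField x c).mono Set.inter_subset_right)
    rw [dirDeriv_coordField hxs
      ((hg.contMDiffAt ((hU.inter hsrc).mem_nhds ⟨hx, hxs⟩)).mdifferentiableAt (by simp))]
    have hev : ((fun y => dirDeriv σ y (coordField x c y)) ∘ (extChartAt (𝓡 2) x).symm)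
        =ᶠ[𝓝 (extChartAt (𝓡 2) x x)]
          fun u => fderiv ℝ (σ ∘ (extChartAt (𝓡 2) x).symm) u c := by
      filter_upwards [eventually_chart ((hU.inter hsrc).mem_nhds ⟨hx, hxs⟩),
        extChartAt_target_mem_nhds (I := 𝓡 2) x] with u hu hut
      rw [Function.comp_apply, dirDeriv_coordField hu.2
        ((hσ.contMDiffAt (hU.mem_nhds hu.1)).mdifferentiableAt (by simp)),
        (extChartAt (𝓡 2) x).right_inv hut]
    rw [hev.fderiv_eq, fderiv_clm_apply hd (differentiableAt_const c)]
    simp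
  rw [key, key]
  exact hs.isSymmSndFDerivAt
    (by rw [minSmoothness_of_isRCLikeNormedField]; exact WithTop.coe_le_coe.2 le_top) b a

end LieSphere
end

noncomputable section

namespace LieSphere

variable {M : Type*} [TopologicalSpace M] [ChartedSpace (EuclideanSpace ℝ (Fin 2)) M]

/-! ### Curvature spheres and curvature subbundles -/

section Curvature

variable {f : M → Submodule ℝ R42} {s : Fin 2 → M → Submodule ℝ R42}

lemma IsUmbilicFree.le (hs : IsUmbilicFree f s) (i : Fin 2) (x : M) : s i x ≤ f x :=
  (hs.curvatureSphere i x).2.1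

lemma IsUmbilicFree.isSection (hs : IsUmbilicFree f s) {i : Fin 2} {U : Set M} {σ : M → R42}
    (h : IsSection (s i) U σ) : IsSection f U σ :=
  h.mono h.isOpen le_rfl fun y _ => hs.le i y

lemma IsUmbilicFree.disjoint_rev (hs : IsUmbilicFree f s) (i : Fin 2) (x : M) :
    Disjoint (s i x) (s i.rev x) := by
  fin_cases i
  · exact hs.disjoint x
  · exact (hs.disjoint x).symm

lemma IsLegendre.sup_eq (hf : IsLegendre f) (hs : IsUmbilicFree f s) (i : Fin 2) (x : M) :
    s i x ⊔ s i.rev x = f x := by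
  refine Submodule.eq_of_le_of_finrank_eq (sup_le (hs.le i x) (hs.le i.rev x)) ?_
  have h := Submodule.finrank_sup_add_finrank_inf_eq (s i x) (s i.rev x)
  rw [(hs.disjoint_rev i x).eq_bot, finrank_bot, (hs.curvatureSphere i x).1,
    (hs.curvatureSphere i.rev x).1] at h
  rw [hf.subbundle.finrank_eq x]
  omega

/-- The curvature subbundle is determined by the derivative of a frame of the curvature sphere. -/
lemma mem_curvatureSpace_iff (hf : IsLegendre f) {S : Submodule ℝ R42} {U : Set M}
    {σ : M → R42} (hσ : IsSection f U σ) {x : M} (hx : x ∈ U)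
    (hspan : S = Submodule.span ℝ {σ x}) (X : TangentSpace (𝓡 2) x) :
    X ∈ curvatureSpace f S x ↔ dirDeriv σ x X ∈ f x := by
  constructor
  · exact fun h => h U σ hσ hx (hspan ▸ Submodule.mem_span_singleton_self _)
  · intro h V ρ hρ hxV hρx
    rw [hspan] at hρx
    obtain ⟨c, hc⟩ := Submodule.mem_span_singleton.1 hρx
    have h1 := hf.subbundle.dirDeriv_sub_mem hρ (hσ.const_smul c) hxV hx hc.symm X
    rw [dirDeriv_const_smul c (hσ.mdifferentiableAt hx)] at h1
    simpa using (f x).add_mem h1 ((f x).smul_mem c h)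

/-- The two curvature subbundles intersect trivially. -/
lemma eq_zero_of_mem_curvatureBundle (hf : IsLegendre f) (hs : IsUmbilicFree f s) {i : Fin 2}
    {x : M} {X : TangentSpace (𝓡 2) x} (h : X ∈ curvatureBundle f s i x)
    (h' : X ∈ curvatureBundle f s i.rev x) : X = 0 := by
  refine hf.immersed x X fun U ρ hρ hx => ?_
  have hm := hρ.mem x hx
  rw [← hf.sup_eq hs i x] at hm
  obtain ⟨a, ha, b, hb, hab⟩ := Submodule.mem_sup.1 hm
  obtain ⟨V, σ, hxV, hσ, rfl⟩ := (hs.subbundle i).exists_section ha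
  obtain ⟨W, τ, hxW, hτ, rfl⟩ := (hs.subbundle i.rev).exists_section hb
  have ho := hσ.isOpen.inter hτ.isOpen
  have hστ := ((hs.isSection hσ).mono ho Set.inter_subset_left fun _ _ => le_rfl).add
    ((hs.isSection hτ).mono ho Set.inter_subset_right fun _ _ => le_rfl)
  have h1 := hf.subbundle.dirDeriv_sub_mem hρ hστ hx ⟨hxV, hxW⟩ hab.symm X
  rw [dirDeriv_add (hσ.mdifferentiableAt hxV) (hτ.mdifferentiableAt hxW)] at h1
  have h2 := (f x).add_mem (h V σ (hs.isSection hσ) hxV ha) (h' W τ (hs.isSection hτ) hxW hb)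
  simpa using (f x).add_mem h1 h2

variable [IsManifold (𝓡 2) ∞ M]

lemma exists_smul_add_smul_eq {a b : EuclideanSpace ℝ (Fin 2)}
    (h : LinearIndependent ℝ ![a, b]) (c : EuclideanSpace ℝ (Fin 2)) :
    ∃ α β : ℝ, c = α • a + β • b := by
  have h1 := h.span_eq_top_of_card_eq_finrank (by simp)
  have h2 : c ∈ Submodule.span ℝ (Set.range ![a, b]) := h1 ▸ Submodule.mem_top
  obtain ⟨d, hd⟩ := (Submodule.mem_span_range_iff_exists_fun ℝ).1 h2
  exact ⟨d 0, d 1, by rw [← hd]; simp [Fin.sum_univ_two]⟩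

/-- The curvature subbundles are smooth line fields. -/
lemma exists_isTangentField (hf : IsLegendre f) (hs : IsUmbilicFree f s) (i : Fin 2) (x : M) :
    ∃ (V : Set M) (Y : (y : M) → TangentSpace (𝓡 2) y), x ∈ V ∧
      IsTangentField (curvatureBundle f s i) V Y ∧
      ∀ y ∈ V, Y y ≠ 0 ∧ curvatureBundle f s i y = Submodule.span ℝ {Y y} := by
  obtain ⟨U, τ, hxU, hτ, hτs⟩ := (hs.subbundle i).exists_frame_one x
  have hτf := hs.isSection hτ
  have hT : ∀ y ∈ U, ∀ X, X ∈ curvatureBundle f s i y ↔ dirDeriv τ y X ∈ f y :=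
    fun y hy X => mem_curvatureSpace_iff hf hτf hy (hτs y hy).2 X
  obtain ⟨Z, hZ, hZ0⟩ := Submodule.exists_mem_ne_zero_of_ne_bot
    (hs.curvatureSphere i.rev x).2.2
  obtain ⟨W, hW, hW0⟩ := Submodule.exists_mem_ne_zero_of_ne_bot
    (hs.curvatureSphere i x).2.2
  have hxs := mem_chart_source (EuclideanSpace ℝ (Fin 2)) x
  obtain ⟨a, rfl⟩ := exists_coordField_eq hxs Z
  obtain ⟨b, rfl⟩ := exists_coordField_eq hxs W
  have hab : LinearIndependent ℝ ![a, b] := by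
    rw [LinearIndependent.pair_iff]
    intro p q hpq
    have h1 : p • coordField x a x + q • coordField x b x = 0 := by
      rw [← coordField_smul, ← coordField_smul, ← coordField_add, hpq]
      exact map_zero _
    have hp : p = 0 := by
      by_contra hp
      refine hZ0 (eq_zero_of_mem_curvatureBundle hf hs (i := i) ?_ hZ)
      have h2 : p • coordField x a x ∈ curvatureBundle f s i x := by
        rw [eq_neg_of_add_eq_zero_left h1]
        exact Submodule.neg_mem _ (Submodule.smul_mem _ _ hW)
      exact (Submodule.smul_mem_iff _ hp).1 h2
    refine ⟨hp, ?_⟩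
    rw [hp, zero_smul, zero_add] at h1
    exact (smul_eq_zero.1 h1).resolve_right hW0
  set V0 := U ∩ (chartAt (EuclideanSpace ℝ (Fin 2)) x).source with hV0
  have hV0o : IsOpen V0 := hτ.isOpen.inter (chartAt (EuclideanSpace ℝ (Fin 2)) x).open_source
  let g : EuclideanSpace ℝ (Fin 2) → M → R42 := fun c y => dirDeriv τ y (coordField x c y)
  have hcf : ∀ c, ContMDiffOn (𝓡 2) (𝓡 2).tangent ∞
      (fun y => (⟨y, coordField x c y⟩ : TangentBundle (𝓡 2) M)) V0 :=
    fun c => (contMDiffOn_coordField x c).mono Set.inter_subset_right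
  have hg : ∀ c, ContMDiffOn (𝓡 2) 𝓘(ℝ, R42) ∞ (g c) V0 := fun c =>
    contMDiffOn_dirDeriv hV0o (hτ.smooth.mono Set.inter_subset_left) (hcf c)
  have hgp : ∀ c, ∀ y ∈ V0, g c y ∈ perp (f y) := fun c y hy => hf.contact U τ hτf y hy.1 _
  let h : EuclideanSpace ℝ (Fin 2) → M → ℝ := fun c y => form (g c y) (g a y)
  have hh : ∀ c, ContMDiffOn (𝓡 2) 𝓘(ℝ, ℝ) ∞ (h c) V0 := fun c => contMDiffOn_form (hg c) (hg a)
  -- The direction a comes from the other curvature subbundle, so d_aτ lies in f^⊥ but not in f at x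
  -- and has positive square. This persists on the open set V.
  have hax : h a x ≠ 0 := by
    refine (form_self_pos_of_mem_perp (hf.null x) (hf.subbundle.finrank_eq x)
      (hgp a x ⟨hxU, hxs⟩) fun hm => ?_).ne'
    exact hZ0 (eq_zero_of_mem_curvatureBundle hf hs (i := i) ((hT x hxU _).2 hm) hZ)
  set V := V0 ∩ h a ⁻¹' {0}ᶜ with hV
  have hVo : IsOpen V :=
    (hh a).continuousOn.isOpen_inter_preimage hV0o isOpen_compl_singleton
  -- If αa + βb lies in `T_i`, then its derivative of τ lies in f, hence is orthogonal to d_aτ: α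
  -- h_a + β h_b = 0. The field Y is the smooth solution of this equation. It spans `T_i` because
  -- `T_i` is non-zero at each point.
  let Y : (y : M) → TangentSpace (𝓡 2) y := fun y =>
    h a y • coordField x b y - h b y • coordField x a y
  have hYeq : ∀ y, Y y = coordField x (h a y • b + (-h b y) • a) y := by
    intro y
    rw [coordField_add, coordField_smul, coordField_smul, neg_smul, ← sub_eq_add_neg]
  have hY0 : ∀ y ∈ V, Y y ≠ 0 := by
    intro y hy h0
    rw [hYeq] at h0
    have h1 := coordField_injective hy.1.2 h0
    rw [add_comm] at h1
    exact hy.2 (LinearIndependent.pair_iff.1 hab _ _ h1).2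
  have hkey : ∀ y ∈ V, ∀ X ∈ curvatureBundle f s i y, ∃ β : ℝ, h a y • X = β • Y y := by
    intro y hy X hX
    obtain ⟨c, rfl⟩ := exists_coordField_eq hy.1.2 X
    obtain ⟨α, β, rfl⟩ := exists_smul_add_smul_eq hab c
    have h1 := (hT y hy.1.1 _).1 hX
    have h2 := mem_perp.1 (hgp a y hy.1) _ h1
    have h3 : dirDeriv τ y (coordField x (α • a + β • b) y) = α • g a y + β • g b y := by
      rw [coordField_add, coordField_smul, coordField_smul]
      simp only [dirDeriv, map_add, map_smul]
      rfl
    have h4 : α * h a y + β * h b y = 0 := by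
      rw [h3] at h2
      simpa [h] using h2
    refine ⟨β, ?_⟩
    rw [coordField_add, coordField_smul, coordField_smul]
    have h5 : h a y * α = -(β * h b y) := by linarith
    simp only [Y, smul_add, smul_sub, smul_smul, h5, neg_smul, mul_comm (h a y) β]
    abel
  have hYm : ∀ y ∈ V, Y y ∈ curvatureBundle f s i y := by
    intro y hy
    obtain ⟨X, hX, hX0⟩ := Submodule.exists_mem_ne_zero_of_ne_bot
      (hs.curvatureSphere i y).2.2
    obtain ⟨β, hβ⟩ := hkey y hy X hX
    have hβ0 : β ≠ 0 := by
      rintro rfl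
      rw [zero_smul] at hβ
      exact (smul_ne_zero hy.2 hX0) hβ
    exact (Submodule.smul_mem_iff _ hβ0).1 (hβ ▸ Submodule.smul_mem _ _ hX)
  refine ⟨V, Y, ⟨⟨hxU, hxs⟩, hax⟩, ⟨hVo, ?_, hYm⟩, fun y hy => ⟨hY0 y hy, ?_⟩⟩
  · have h1 := ((hh a).mono Set.inter_subset_left).smul_section
      ((hcf b).mono (Set.inter_subset_left (t := h a ⁻¹' {0}ᶜ)))
    have h2 := ((hh b).mono Set.inter_subset_left).smul_section
      ((hcf a).mono (Set.inter_subset_left (t := h a ⁻¹' {0}ᶜ)))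
    exact h1.sub_section h2
  · refine le_antisymm (fun X hX => ?_)
      ((Submodule.span_singleton_le_iff_mem _ _).2 (hYm y hy))
    obtain ⟨β, hβ⟩ := hkey y hy X hX
    refine Submodule.mem_span_singleton.2 ⟨(h a y)⁻¹ * β, ?_⟩
    rw [mul_smul, ← hβ, smul_smul, inv_mul_cancel₀ hy.2, one_smul]

end Curvature

end LieSphere
end

noncomputable section

namespace LieSphere

variable {M : Type*} [TopologicalSpace M] [ChartedSpace (EuclideanSpace ℝ (Fin 2)) M]
  [IsManifold (𝓡 2) ∞ M]

/-! ### Adapted frames -/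

/-- Smooth local sections `σ`, `τ` and vector fields `X`, `Y` spanning the two curvature sphere
congruences and the two curvature subbundles. -/
structure AdaptedFrame (f : M → Submodule ℝ R42) (s : Fin 2 → M → Submodule ℝ R42) (i : Fin 2)
    (U : Set M) (σ τ : M → R42) (X Y : (y : M) → TangentSpace (𝓡 2) y) : Prop where
  left : IsSection (s i) U σ
  right : IsSection (s i.rev) U τ
  span_left : ∀ y ∈ U, s i y = Submodule.span ℝ {σ y}
  span_right : ∀ y ∈ U, s i.rev y = Submodule.span ℝ {τ y}
  left_ne : ∀ y ∈ U, σ y ≠ 0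
  fieldX : IsTangentField (curvatureBundle f s i) U X
  fieldY : IsTangentField (curvatureBundle f s i.rev) U Y
  spanX : ∀ y ∈ U, curvatureBundle f s i y = Submodule.span ℝ {X y}
  spanY : ∀ y ∈ U, curvatureBundle f s i.rev y = Submodule.span ℝ {Y y}
  X_ne : ∀ y ∈ U, X y ≠ 0
  Y_ne : ∀ y ∈ U, Y y ≠ 0

variable {f : M → Submodule ℝ R42} {s : Fin 2 → M → Submodule ℝ R42} {i : Fin 2}

lemma exists_adaptedFrame (hf : IsLegendre f) (hs : IsUmbilicFree f s) (i : Fin 2) (x : M) :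
    ∃ (U : Set M) (σ τ : M → R42) (X Y : (y : M) → TangentSpace (𝓡 2) y),
      x ∈ U ∧ AdaptedFrame f s i U σ τ X Y := by
  obtain ⟨U₁, σ, h₁, hσ, hσs⟩ := (hs.subbundle i).exists_frame_one x
  obtain ⟨U₂, τ, h₂, hτ, hτs⟩ := (hs.subbundle i.rev).exists_frame_one x
  obtain ⟨U₃, X, h₃, hX, hXs⟩ := exists_isTangentField hf hs i x
  obtain ⟨U₄, Y, h₄, hY, hYs⟩ := exists_isTangentField hf hs i.rev x
  have hU : IsOpen (U₁ ∩ U₂ ∩ (U₃ ∩ U₄)) :=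
    (hσ.isOpen.inter hτ.isOpen).inter (hX.isOpen.inter hY.isOpen)
  have i₁ : U₁ ∩ U₂ ∩ (U₃ ∩ U₄) ⊆ U₁ := fun y hy => hy.1.1
  have i₂ : U₁ ∩ U₂ ∩ (U₃ ∩ U₄) ⊆ U₂ := fun y hy => hy.1.2
  have i₃ : U₁ ∩ U₂ ∩ (U₃ ∩ U₄) ⊆ U₃ := fun y hy => hy.2.1
  have i₄ : U₁ ∩ U₂ ∩ (U₃ ∩ U₄) ⊆ U₄ := fun y hy => hy.2.2
  exact ⟨U₁ ∩ U₂ ∩ (U₃ ∩ U₄), σ, τ, X, Y, ⟨⟨h₁, h₂⟩, h₃, h₄⟩,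
    { left := hσ.mono hU i₁ fun _ _ => le_rfl
      right := hτ.mono hU i₂ fun _ _ => le_rfl
      span_left := fun y hy => (hσs y (i₁ hy)).2
      span_right := fun y hy => (hτs y (i₂ hy)).2
      left_ne := fun y hy => (hσs y (i₁ hy)).1
      fieldX := ⟨hU, hX.smooth.mono i₃, fun y hy => hX.mem y (i₃ hy)⟩
      fieldY := ⟨hU, hY.smooth.mono i₄, fun y hy => hY.mem y (i₄ hy)⟩
      spanX := fun y hy => (hXs y (i₃ hy)).2
      spanY := fun y hy => (hYs y (i₄ hy)).2
      X_ne := fun y hy => (hXs y (i₃ hy)).1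
      Y_ne := fun y hy => (hYs y (i₄ hy)).1 }⟩

/-! ### First derivatives of an adapted frame -/

namespace AdaptedFrame

variable {U : Set M} {σ τ : M → R42} {X Y : (y : M) → TangentSpace (𝓡 2) y}

lemma isOpen (F : AdaptedFrame f s i U σ τ X Y) : IsOpen U := F.left.isOpen

lemma span_eq (F : AdaptedFrame f s i U σ τ X Y) (hf : IsLegendre f) (hs : IsUmbilicFree f s)
    {y : M} (hy : y ∈ U) : f y = Submodule.span ℝ {σ y, τ y} := by
  rw [← hf.sup_eq hs i y, F.span_left y hy, F.span_right y hy, Submodule.span_insert]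

lemma leftf (F : AdaptedFrame f s i U σ τ X Y) (hs : IsUmbilicFree f s) : IsSection f U σ :=
  hs.isSection F.left

lemma rightf (F : AdaptedFrame f s i U σ τ X Y) (hs : IsUmbilicFree f s) : IsSection f U τ :=
  hs.isSection F.right

lemma contMDiffOn_dY (F : AdaptedFrame f s i U σ τ X Y) :
    ContMDiffOn (𝓡 2) 𝓘(ℝ, R42) ∞ (fun y => dirDeriv σ y (Y y)) U :=
  contMDiffOn_dirDeriv F.isOpen F.left.smooth F.fieldY.smooth

variable {y : M}

lemma dX_left_mem (F : AdaptedFrame f s i U σ τ X Y) (hs : IsUmbilicFree f s) (hy : y ∈ U) :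
    dirDeriv σ y (X y) ∈ f y :=
  F.fieldX.mem y hy U σ (F.leftf hs) hy (F.left.mem y hy)

lemma dY_right_mem (F : AdaptedFrame f s i U σ τ X Y) (hs : IsUmbilicFree f s) (hy : y ∈ U) :
    dirDeriv τ y (Y y) ∈ f y :=
  F.fieldY.mem y hy U τ (F.rightf hs) hy (F.right.mem y hy)

lemma dY_left_notMem (F : AdaptedFrame f s i U σ τ X Y) (hf : IsLegendre f)
    (hs : IsUmbilicFree f s) (hy : y ∈ U) : dirDeriv σ y (Y y) ∉ f y := fun h =>
  F.Y_ne y hy <| eq_zero_of_mem_curvatureBundle hf hs (i := i)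
    ((mem_curvatureSpace_iff hf (F.leftf hs) hy (F.span_left y hy) _).2 h) (F.fieldY.mem y hy)

lemma dX_right_notMem (F : AdaptedFrame f s i U σ τ X Y) (hf : IsLegendre f)
    (hs : IsUmbilicFree f s) (hy : y ∈ U) : dirDeriv τ y (X y) ∉ f y := fun h =>
  F.X_ne y hy <| eq_zero_of_mem_curvatureBundle hf hs (i := i) (F.fieldX.mem y hy)
    ((mem_curvatureSpace_iff hf (F.rightf hs) hy (F.span_right y hy) _).2 h)

lemma dY_left_mem_perp (F : AdaptedFrame f s i U σ τ X Y) (hf : IsLegendre f)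
    (hs : IsUmbilicFree f s) (hy : y ∈ U) : dirDeriv σ y (Y y) ∈ perp (f y) :=
  hf.contact U σ (F.leftf hs) y hy _

lemma dX_right_mem_perp (F : AdaptedFrame f s i U σ τ X Y) (hf : IsLegendre f)
    (hs : IsUmbilicFree f s) (hy : y ∈ U) : dirDeriv τ y (X y) ∈ perp (f y) :=
  hf.contact U τ (F.rightf hs) y hy _

lemma form_dY_left_pos (F : AdaptedFrame f s i U σ τ X Y) (hf : IsLegendre f)
    (hs : IsUmbilicFree f s) (hy : y ∈ U) :
    0 < form (dirDeriv σ y (Y y)) (dirDeriv σ y (Y y)) :=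
  form_self_pos_of_mem_perp (hf.null y) (hf.subbundle.finrank_eq y)
    (F.dY_left_mem_perp hf hs hy) (F.dY_left_notMem hf hs hy)

lemma form_dX_right_pos (F : AdaptedFrame f s i U σ τ X Y) (hf : IsLegendre f)
    (hs : IsUmbilicFree f s) (hy : y ∈ U) :
    0 < form (dirDeriv τ y (X y)) (dirDeriv τ y (X y)) :=
  form_self_pos_of_mem_perp (hf.null y) (hf.subbundle.finrank_eq y)
    (F.dX_right_mem_perp hf hs hy) (F.dX_right_notMem hf hs hy)

end AdaptedFrame

/-- Symmetry of the bilinear form `(d_A σ, d_B τ)` for sections of a Legendre map. -/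
lemma IsLegendre.form_dirDeriv_comm (hf : IsLegendre f) {U : Set M} {σ τ : M → R42}
    (hσ : IsSection f U σ) (hτ : IsSection f U τ) {x : M} (hx : x ∈ U)
    (A B : TangentSpace (𝓡 2) x) :
    form (dirDeriv σ x A) (dirDeriv τ x B) = form (dirDeriv σ x B) (dirDeriv τ x A) := by
  have hxs := mem_chart_source (EuclideanSpace ℝ (Fin 2)) x
  obtain ⟨a, rfl⟩ := exists_coordField_eq hxs A
  obtain ⟨b, rfl⟩ := exists_coordField_eq hxs B
  have hV : IsOpen (U ∩ (chartAt (EuclideanSpace ℝ (Fin 2)) x).source) :=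
    hσ.isOpen.inter (chartAt (EuclideanSpace ℝ (Fin 2)) x).open_source
  -- This is the contact condition (d_cσ, τ) = 0 differentiated in the direction d. Its
  -- second-derivative term is symmetric in c and d, so the other term is symmetric too.
  have key : ∀ c d : EuclideanSpace ℝ (Fin 2),
      form (dirDeriv (fun y => dirDeriv σ y (coordField x c y)) x (coordField x d x)) (τ x) +
        form (dirDeriv σ x (coordField x c x)) (dirDeriv τ x (coordField x d x)) = 0 := by
    intro c d
    refine form_dirDeriv_add_eq_zero (c := 0) (mdifferentiableAt_of_contMDiffOn
      (contMDiffOn_dirDeriv hV (hσ.smooth.mono Set.inter_subset_left)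
        ((contMDiffOn_coordField x c).mono Set.inter_subset_right)) hV ⟨hx, hxs⟩)
      (hτ.mdifferentiableAt hx) ?_ _
    filter_upwards [hσ.isOpen.mem_nhds hx] with y hy
    rw [form_comm]
    exact mem_perp.1 (hf.contact U σ hσ y hy _) _ (hτ.mem y hy)
  have h1 := key a b
  have h2 := key b a
  rw [dirDeriv_coordField_comm hσ.isOpen hx hσ.smooth] at h1
  linarith

/-! ### Orthogonality relations and second derivatives in an adapted frame -/

namespace AdaptedFrame

variable {U : Set M} {σ τ : M → R42} {X Y : (y : M) → TangentSpace (𝓡 2) y} {y : M}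

/-- Symmetry turns the pairing into (d_Xσ, d_Yτ), whose two entries both lie in the null plane f. -/
lemma form_dY_left_dX_right (F : AdaptedFrame f s i U σ τ X Y) (hf : IsLegendre f)
    (hs : IsUmbilicFree f s) (hy : y ∈ U) :
    form (dirDeriv σ y (Y y)) (dirDeriv τ y (X y)) = 0 := by
  rw [hf.form_dirDeriv_comm (F.leftf hs) (F.rightf hs) hy]
  exact form_self_eq_zero_of_null (hf.null y) (F.dX_left_mem hs hy) (F.dY_right_mem hs hy)

/-- The vectors of `f^⊥` are combinations of `f`, `d_Y σ` and `d_X τ`. -/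
lemma sub_smul_mem (F : AdaptedFrame f s i U σ τ X Y) (hf : IsLegendre f)
    (hs : IsUmbilicFree f s) (hy : y ∈ U) {v : R42} (hv : v ∈ perp (f y))
    (hvX : form v (dirDeriv τ y (X y)) = 0) :
    ∃ c : ℝ, v - c • dirDeriv σ y (Y y) ∈ f y :=
  exists_sub_smul_mem (hf.null y) (hf.subbundle.finrank_eq y) (F.dY_left_mem_perp hf hs hy)
    (F.dX_right_mem_perp hf hs hy) (F.form_dY_left_pos hf hs hy) (F.form_dX_right_pos hf hs hy)
    (F.form_dY_left_dX_right hf hs hy) hv hvX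

/-- The curvature sphere congruences of a regular surface are immersed along their own curvature
lines. -/
lemma dX_left_notMem (F : AdaptedFrame f s i U σ τ X Y) (hs : IsUmbilicFree f s)
    (hreg : IsRegularPair s) (hy : y ∈ U) : dirDeriv σ y (X y) ∉ s i y := by
  intro h
  refine F.X_ne y hy (hreg i y (X y) fun V ρ hρ hyV => ?_)
  have hm := hρ.mem y hyV
  rw [F.span_left y hy] at hm
  obtain ⟨c, hc⟩ := Submodule.mem_span_singleton.1 hm
  have h1 := (hs.subbundle i).dirDeriv_sub_mem hρ (F.left.const_smul c) hyV hy hc.symm (X y)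
  rw [dirDeriv_const_smul c (F.left.mdifferentiableAt hy)] at h1
  simpa using (s i y).add_mem h1 ((s i y).smul_mem c h)

/-- Differentiate (σ, d_Yσ) = 0 and (τ, d_Yσ) = 0 along X. The remaining terms (d_Xσ, d_Yσ) and
(d_Xτ, d_Yσ) vanish, the first since d_Xσ lies in f and the second by `form_dY_left_dX_right`. -/
lemma dX_dY_left_mem_perp (F : AdaptedFrame f s i U σ τ X Y) (hf : IsLegendre f)
    (hs : IsUmbilicFree f s) (hy : y ∈ U) :
    dirDeriv (fun z => dirDeriv σ z (Y z)) y (X y) ∈ perp (f y) := by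
  have h1 := form_dirDeriv_add_eq_zero (c := 0) (F.left.mdifferentiableAt hy)
    (mdifferentiableAt_of_contMDiffOn F.contMDiffOn_dY F.isOpen hy)
    (by filter_upwards [F.isOpen.mem_nhds hy] with z hz
        exact mem_perp.1 (F.dY_left_mem_perp hf hs hz) _ ((F.leftf hs).mem z hz)) (X y)
  have h2 := form_dirDeriv_add_eq_zero (c := 0) (F.right.mdifferentiableAt hy)
    (mdifferentiableAt_of_contMDiffOn F.contMDiffOn_dY F.isOpen hy)
    (by filter_upwards [F.isOpen.mem_nhds hy] with z hz
        exact mem_perp.1 (F.dY_left_mem_perp hf hs hz) _ ((F.rightf hs).mem z hz)) (X y)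
  rw [mem_perp.1 (F.dY_left_mem_perp hf hs hy) _ (F.dX_left_mem hs hy), zero_add] at h1
  rw [form_comm, F.form_dY_left_dX_right hf hs hy, zero_add] at h2
  rw [mem_perp, F.span_eq hf hs hy]
  intro w hw
  obtain ⟨a, b, rfl⟩ := Submodule.mem_span_pair.1 hw
  simp [h1, h2]

/-- Differentiating (σ, d_Yσ) = 0 along Y gives (σ, d_Yd_Yσ) = -(d_Yσ, d_Yσ) < 0. -/
lemma form_left_dY_dY_left (F : AdaptedFrame f s i U σ τ X Y) (hf : IsLegendre f)
    (hs : IsUmbilicFree f s) (hy : y ∈ U) :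
    form (σ y) (dirDeriv (fun z => dirDeriv σ z (Y z)) y (Y y)) ≠ 0 := by
  have h1 := form_dirDeriv_add_eq_zero (c := 0) (F.left.mdifferentiableAt hy)
    (mdifferentiableAt_of_contMDiffOn F.contMDiffOn_dY F.isOpen hy)
    (by filter_upwards [F.isOpen.mem_nhds hy] with z hz
        exact mem_perp.1 (F.dY_left_mem_perp hf hs hz) _ ((F.leftf hs).mem z hz)) (Y y)
  have h2 := F.form_dY_left_pos hf hs hy
  intro h3
  linarith

/-! ### Lie cyclides and osculating complexes in adapted frames -/

/-- The frame `σ`, `d_Y σ`, `d_Y d_Y σ` of the Lie cyclide. -/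
def cyclideFrame (σ : M → R42) (Y : (y : M) → TangentSpace (𝓡 2) y) : Fin 3 → M → R42 :=
  ![σ, fun z => dirDeriv σ z (Y z), fun y => dirDeriv (fun z => dirDeriv σ z (Y z)) y (Y y)]

lemma contMDiffOn_cyclideFrame (F : AdaptedFrame f s i U σ τ X Y) (j : Fin 3) :
    ContMDiffOn (𝓡 2) 𝓘(ℝ, R42) ∞ (cyclideFrame σ Y j) U := by
  fin_cases j
  · exact F.left.smooth
  · exact F.contMDiffOn_dY
  · exact contMDiffOn_dirDeriv F.isOpen F.contMDiffOn_dY F.fieldY.smooth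

omit [IsManifold (𝓡 2) ∞ M] in
lemma mem_span_cyclideFrame {v : R42} :
    v ∈ Submodule.span ℝ (Set.range fun j => cyclideFrame σ Y j y) ↔ ∃ a b c : ℝ,
      a • σ y + b • dirDeriv σ y (Y y) +
        c • dirDeriv (fun z => dirDeriv σ z (Y z)) y (Y y) = v := by
  rw [Submodule.mem_span_range_iff_exists_fun]
  constructor
  · rintro ⟨c, rfl⟩
    exact ⟨c 0, c 1, c 2, by simp [Fin.sum_univ_three, cyclideFrame]⟩
  · rintro ⟨a, b, c, rfl⟩
    exact ⟨![a, b, c], by simp [Fin.sum_univ_three, cyclideFrame]⟩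

/-- Pairing with σ leaves only c(σ, d_Yd_Yσ). So the part of the Lie cyclide inside f^⊥ involves no
second derivative. -/
lemma eq_zero_of_mem_perp (F : AdaptedFrame f s i U σ τ X Y) (hf : IsLegendre f)
    (hs : IsUmbilicFree f s) (hy : y ∈ U) {a b c : ℝ}
    (h : a • σ y + b • dirDeriv σ y (Y y) +
      c • dirDeriv (fun z => dirDeriv σ z (Y z)) y (Y y) ∈ perp (f y)) : c = 0 := by
  have hσ := (F.leftf hs).mem y hy
  have h1 := mem_perp.1 h _ hσ
  rw [map_add, map_add, map_smul, map_smul, map_smul,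
    form_self_eq_zero_of_null (hf.null y) hσ hσ,
    mem_perp.1 (F.dY_left_mem_perp hf hs hy) _ hσ] at h1
  simpa [F.form_left_dY_dY_left hf hs hy] using h1

lemma eq_zero_of_mem (F : AdaptedFrame f s i U σ τ X Y) (hf : IsLegendre f)
    (hs : IsUmbilicFree f s) (hy : y ∈ U) {a b : ℝ}
    (h : a • σ y + b • dirDeriv σ y (Y y) ∈ f y) : b = 0 := by
  by_contra hb
  refine F.dY_left_notMem hf hs hy (((f y).smul_mem_iff hb).1 ?_)
  simpa using (f y).sub_mem h ((f y).smul_mem a ((F.leftf hs).mem y hy))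

lemma linearIndependent_cyclideFrame (F : AdaptedFrame f s i U σ τ X Y) (hf : IsLegendre f)
    (hs : IsUmbilicFree f s) (hy : y ∈ U) :
    LinearIndependent ℝ fun j => cyclideFrame σ Y j y := by
  rw [Fintype.linearIndependent_iff]
  intro c hc
  rw [Fin.sum_univ_three] at hc
  have h0 : c 0 • σ y + c 1 • dirDeriv σ y (Y y) +
      c 2 • dirDeriv (fun z => dirDeriv σ z (Y z)) y (Y y) = 0 := by
    simpa [cyclideFrame] using hc
  have h2 : c 2 = 0 := F.eq_zero_of_mem_perp hf hs hy (h0 ▸ (perp (f y)).zero_mem)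
  rw [h2, zero_smul, add_zero] at h0
  have h1 : c 1 = 0 := F.eq_zero_of_mem hf hs hy (h0 ▸ (f y).zero_mem)
  rw [h1, zero_smul, add_zero] at h0
  have h3 : c 0 = 0 := (smul_eq_zero.1 h0).resolve_right (F.left_ne y hy)
  intro j
  fin_cases j <;> assumption

/-- At each point ρ and Z are multiples of σ and Y, and rescaling σ changes its derivative only by
multiples of σ. This is the first-order half of the independence of the Lie cyclide from the choice
of sections and fields. -/
lemma dirDeriv_section_mem (F : AdaptedFrame f s i U σ τ X Y) (hs : IsUmbilicFree f s)
    (hy : y ∈ U) {V : Set M} {ρ : M → R42} {Z : (y : M) → TangentSpace (𝓡 2) y}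
    (hρ : IsSection (s i) V ρ) (hZ : IsTangentField (curvatureBundle f s i.rev) V Z)
    (hyV : y ∈ V) : ∃ a b : ℝ, a • σ y + b • dirDeriv σ y (Y y) = dirDeriv ρ y (Z y) := by
  have hm := hρ.mem y hyV
  rw [F.span_left y hy] at hm
  obtain ⟨c, hc⟩ := Submodule.mem_span_singleton.1 hm
  have hZm := hZ.mem y hyV
  rw [F.spanY y hy] at hZm
  obtain ⟨k, hk⟩ := Submodule.mem_span_singleton.1 hZm
  have h1 := (hs.subbundle i).dirDeriv_sub_mem hρ (F.left.const_smul c) hyV hy hc.symm (Z y)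
  rw [dirDeriv_const_smul c (F.left.mdifferentiableAt hy), ← hk, F.span_left y hy] at h1
  obtain ⟨a, ha⟩ := Submodule.mem_span_singleton.1 h1
  refine ⟨a, c * k, ?_⟩
  rw [ha, ← hk, mul_smul]
  have h2 : dirDeriv σ y (k • Y y) = k • dirDeriv σ y (Y y) := map_smul _ _ _
  rw [h2]
  abel

lemma lieCyclide_eq (F : AdaptedFrame f s i U σ τ X Y) (hf : IsLegendre f)
    (hs : IsUmbilicFree f s) (hy : y ∈ U) :
    lieCyclide f s i y = Submodule.span ℝ (Set.range fun j => cyclideFrame σ Y j y) := by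
  refine le_antisymm (Submodule.span_le.2 ?_) (Submodule.span_le.2 ?_)
  · rintro v ⟨V, ρ, Z, hyV, hρ, hZ, hv⟩
    rw [SetLike.mem_coe, mem_span_cyclideFrame]
    rcases hv with rfl | rfl | rfl
    · have hm := hρ.mem y hyV
      rw [F.span_left y hy] at hm
      obtain ⟨c, hc⟩ := Submodule.mem_span_singleton.1 hm
      exact ⟨c, 0, 0, by simp [hc]⟩
    · obtain ⟨a, b, h⟩ := F.dirDeriv_section_mem hs hy hρ hZ hyV
      exact ⟨a, b, 0, by simp [h]⟩
    · obtain ⟨a, b, h⟩ := F.dirDeriv_section_mem hs hy hρ hZ hyV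
      have hσd := F.left.mdifferentiableAt hy
      have hYd := mdifferentiableAt_of_contMDiffOn F.contMDiffOn_dY F.isOpen hy
      let e : Fin 2 → M → R42 := ![σ, fun z => dirDeriv σ z (Y z)]
      have hspan : ∀ z, ∀ v, v ∈ Submodule.span ℝ (Set.range fun j => e j z) ↔
          ∃ a b : ℝ, a • σ z + b • dirDeriv σ z (Y z) = v := by
        intro z v
        rw [Submodule.mem_span_range_iff_exists_fun]
        constructor
        · rintro ⟨c, rfl⟩
          exact ⟨c 0, c 1, by simp [e]⟩
        · rintro ⟨a, b, rfl⟩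
          exact ⟨![a, b], by simp [e]⟩
      have hli : LinearIndependent ℝ fun j => e j y := by
        have := (F.linearIndependent_cyclideFrame hf hs hy).comp (Fin.castSucc (n := 2))
          (Fin.castSucc_injective 2)
        convert this using 1
        ext1 j
        fin_cases j <;> rfl
      -- The map d_Zρ takes values in the span of σ and d_Yσ near y. It may be replaced by the
      -- combination with coefficients frozen at y, at the cost of an element of that span.
      have h1 := dirDeriv_sub_mem_span (e := e) (ρ := fun z => dirDeriv ρ z (Z z))
        (τ := fun z => a • σ z + b • dirDeriv σ z (Y z)) (x := y)
        (by intro j; fin_cases j; exacts [hσd, hYd]) hli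
        (mdifferentiableAt_of_contMDiffOn (contMDiffOn_dirDeriv hρ.isOpen hρ.smooth hZ.smooth)
          hρ.isOpen hyV)
        (by filter_upwards [F.isOpen.mem_nhds hy, hρ.isOpen.mem_nhds hyV] with z hz hzV
            exact (hspan z _).2 (F.dirDeriv_section_mem hs hz hρ hZ hzV))
        ((hσd.const_smul a).add (hYd.const_smul b))
        (Filter.Eventually.of_forall fun z => (hspan z _).2 ⟨a, b, rfl⟩) h.symm (Z y)
      rw [dirDeriv_smul_add_smul a b hσd hYd] at h1
      have hZm := hZ.mem y hyV
      rw [F.spanY y hy] at hZm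
      obtain ⟨k, hk⟩ := Submodule.mem_span_singleton.1 hZm
      have h4 : dirDeriv σ y (Z y) = k • dirDeriv σ y (Y y) := by
        rw [← hk]; exact map_smul _ _ _
      have h5 : dirDeriv (fun z => dirDeriv σ z (Y z)) y (Z y) =
          k • dirDeriv (fun z => dirDeriv σ z (Y z)) y (Y y) := by
        rw [← hk]; exact map_smul _ _ _
      rw [h4, h5] at h1
      obtain ⟨p, q, hpq⟩ := (hspan y _).1 h1
      refine ⟨p, q + a * k, b * k, ?_⟩
      rw [eq_add_of_sub_eq hpq.symm]
      module
  · rintro v ⟨j, rfl⟩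
    refine Submodule.subset_span ⟨U, σ, Y, hy, F.left, F.fieldY, ?_⟩
    fin_cases j
    · exact Or.inl rfl
    · exact Or.inr (Or.inl rfl)
    · exact Or.inr (Or.inr rfl)

/-- The osculating complex in an adapted frame. -/
lemma mem_osculatingComplex_iff (F : AdaptedFrame f s i U σ τ X Y) (hf : IsLegendre f)
    (hs : IsUmbilicFree f s) (hy : y ∈ U) {v : R42} :
    v ∈ osculatingComplex f s i y ↔ ∃ a b : ℝ, a • σ y + b • dirDeriv σ y (Y y) = v ∧
      ∃ c d : ℝ, a • dirDeriv σ y (X y) +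
        b • dirDeriv (fun z => dirDeriv σ z (Y z)) y (X y) =
          c • σ y + d • dirDeriv σ y (Y y) := by
  have hσd := F.left.mdifferentiableAt hy
  have hYd := mdifferentiableAt_of_contMDiffOn F.contMDiffOn_dY F.isOpen hy
  have hcomb : ∀ a b : ℝ, IsSection (lieCyclide f s i) U
      (fun z => a • σ z + b • dirDeriv σ z (Y z)) := fun a b =>
    ⟨F.isOpen, (contMDiffOn_const_smul a F.left.smooth).add
      (contMDiffOn_const_smul b F.contMDiffOn_dY), fun z hz => by
        rw [F.lieCyclide_eq hf hs hz, mem_span_cyclideFrame]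
        exact ⟨a, b, 0, by simp⟩⟩
  have hcombd := fun (a b : ℝ) => dirDeriv_smul_add_smul (x := y) a b hσd hYd
  have hpσ : σ y ∈ perp (f y) := hf.null y ((F.leftf hs).mem y hy)
  have hpY := F.dY_left_mem_perp hf hs hy
  constructor
  · rintro ⟨⟨hk, hS⟩, hp⟩
    rw [SetLike.mem_coe, F.lieCyclide_eq hf hs hy, mem_span_cyclideFrame] at hS
    obtain ⟨a, b, c, rfl⟩ := hS
    obtain rfl := F.eq_zero_of_mem_perp hf hs hy hp
    rw [zero_smul, add_zero] at *
    refine ⟨a, b, rfl, ?_⟩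
    simp only [SetLike.mem_coe, Submodule.mem_iInf] at hk
    obtain ⟨V, ρ, hyV, hρ, hρv, hρX⟩ := hk (X y) (F.fieldX.mem y hy)
    -- The section ρ witnessing membership in the kernel is exchanged for the constant-coefficient
    -- combination. Their derivatives differ by an element of the cyclide.
    have h1 := dirDeriv_sub_mem_span (e := cyclideFrame σ Y) (ρ := ρ) (x := y)
      (fun j => mdifferentiableAt_of_contMDiffOn (F.contMDiffOn_cyclideFrame j) F.isOpen hy)
      (F.linearIndependent_cyclideFrame hf hs hy) (hρ.mdifferentiableAt hyV)
      (by filter_upwards [F.isOpen.mem_nhds hy, hρ.isOpen.mem_nhds hyV] with z hz hzV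
          rw [← F.lieCyclide_eq hf hs hz]
          exact hρ.mem z hzV)
      ((hcomb a b).mdifferentiableAt hy)
      (by filter_upwards [F.isOpen.mem_nhds hy] with z hz
          rw [← F.lieCyclide_eq hf hs hz]
          exact (hcomb a b).mem z hz) hρv (X y)
    rw [← F.lieCyclide_eq hf hs hy] at h1
    have h2 := (lieCyclide f s i y).sub_mem hρX h1
    rw [sub_sub_cancel, hcombd, F.lieCyclide_eq hf hs hy, mem_span_cyclideFrame] at h2
    obtain ⟨p, q, r, h3⟩ := h2
    -- The derivative along X stays in f^⊥, which excludes a component along d_Yd_Yσ.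
    have h4 : r = 0 := by
      refine F.eq_zero_of_mem_perp hf hs hy (a := p) (b := q) ?_
      rw [h3]
      exact Submodule.add_mem _ (Submodule.smul_mem _ _ (hf.null y (F.dX_left_mem hs hy)))
        (Submodule.smul_mem _ _ (F.dX_dY_left_mem_perp hf hs hy))
    rw [h4, zero_smul, add_zero] at h3
    exact ⟨p, q, h3.symm⟩
  · rintro ⟨a, b, rfl, c, d, h⟩
    refine ⟨⟨?_, (hcomb a b).mem y hy⟩,
      Submodule.add_mem _ (Submodule.smul_mem _ _ hpσ) (Submodule.smul_mem _ _ hpY)⟩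
    simp only [SetLike.mem_coe, Submodule.mem_iInf]
    intro Z hZ
    rw [F.spanX y hy] at hZ
    obtain ⟨k, rfl⟩ := Submodule.mem_span_singleton.1 hZ
    refine ⟨U, _, hy, hcomb a b, rfl, ?_⟩
    have h1 : dirDeriv (fun z => a • σ z + b • dirDeriv σ z (Y z)) y (k • X y) =
        k • dirDeriv (fun z => a • σ z + b • dirDeriv σ z (Y z)) y (X y) := map_smul _ _ _
    rw [h1, hcombd, h]
    exact Submodule.smul_mem _ _ ((hcomb c d).mem y hy)

end AdaptedFrame

end LieSphere
end

noncomputable section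

namespace LieSphere

variable {M : Type*} [TopologicalSpace M] [ChartedSpace (EuclideanSpace ℝ (Fin 2)) M]

/-! ### Spherical curvature lines and parallel sphere complexes -/

/-- There is a smooth map into `f^⊥ \ f` that is constant along the leaves of `D`. This condition
does not involve a point sphere complex. -/
def HasParallelComplex (f : M → Submodule ℝ R42) (D : Distribution M) : Prop :=
  ∃ κ : M → R42, ContMDiff (𝓡 2) 𝓘(ℝ, R42) ∞ κ ∧ (∀ x, κ x ∈ perp (f x)) ∧
    (∀ x, κ x ∉ f x) ∧ ∀ x, ∀ X ∈ D x, dirDeriv κ x X = 0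

/-- The sphere `n` is moved into `f^⊥` by the point sphere complex `p`. -/
lemma form_ne_zero_and_sub_mem_perp {W N : Submodule ℝ R42} {p v n : R42} (hW : W ≤ perp W)
    (h2 : Module.finrank ℝ W = 2) (hN : N ≤ perp N)
    (hWN : W ⊓ perp (Submodule.span ℝ {p}) ≤ perp N)
    (hd : Disjoint W (N ⊔ Submodule.span ℝ {p})) (hv : v ∈ W) (hpv : form p v ≠ 0)
    (hn : n ∈ N) (hn0 : n ≠ 0) :
    form v n ≠ 0 ∧ p - (form v p / form v n) • n ∈ perp W := by
  -- As (p, v) ≠ 0, the space W is spanned by v and W ∩ p^⊥, so orthogonality to W may be tested on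
  -- these.
  have key : ∀ w, form v w = 0 → (∀ u ∈ W, form p u = 0 → form u w = 0) → w ∈ perp W := by
    intro w hvw h
    rw [mem_perp]
    intro u hu
    have h1 := h (u - (form p u / form p v) • v) (W.sub_mem hu (W.smul_mem _ hv))
      (by rw [map_sub, map_smul, smul_eq_mul, div_mul_cancel₀ _ hpv, sub_self])
    rwa [map_sub, map_smul, LinearMap.sub_apply, LinearMap.smul_apply, hvw, smul_zero,
      sub_zero] at h1
  have hNu : ∀ u ∈ W, form p u = 0 → form u n = 0 := fun u hu hpu => by
    rw [form_comm]
    exact mem_perp.1 (hWN ⟨hu, mem_perp_span_singleton.2 hpu⟩) n hn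
  -- Otherwise n would be a null vector of W^⊥, hence in W, against transversality.
  have hvn : form v n ≠ 0 := by
    intro h0
    have h1 := (form_self_nonneg_of_mem_perp hW h2 (key n h0 hNu)).2
      (form_self_eq_zero_of_null hN hn hn)
    exact hn0 (Submodule.disjoint_def.1 hd n h1 (Submodule.mem_sup_left hn))
  refine ⟨hvn, key _ ?_ ?_⟩
  · rw [map_sub, map_smul, smul_eq_mul, div_mul_cancel₀ _ hvn, sub_self]
  · intro u hu hpu
    rw [map_sub, map_smul, hNu u hu hpu, form_comm, hpu, smul_zero, sub_zero]

/-- Scale ν to the representative n with κ = p + n in f^⊥. Constancy of the line ν gives only d_Xn =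
μn; orthogonality to σ and regularity then force d_Xκ = 0. -/
lemma hasParallelComplex_of_isSphericalAlong [IsManifold (𝓡 2) ∞ M]
    {f : M → Submodule ℝ R42} {s : Fin 2 → M → Submodule ℝ R42}
    (hf : IsLegendre f) (hs : IsUmbilicFree f s) (hreg : IsRegularPair s) {i : Fin 2} {p : R42}
    (hp : form p p < 0) (h : IsSphericalAlong p f (curvatureBundle f s i)) :
    HasParallelComplex f (curvatureBundle f s i) := by
  obtain ⟨ν, hν, hνnull, hνc, hνp, hνd⟩ := h
  have h2 := hf.subbundle.finrank_eq
  have hpperp : ∀ x, p ∉ perp (f x) := fun x hx => by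
    linarith [(form_self_nonneg_of_mem_perp (hf.null x) (h2 x) hx).1]
  have hex : ∀ x, ∃ n ∈ ν x, p + n ∈ perp (f x) := by
    intro x
    obtain ⟨v, hv, hpv⟩ := exists_mem_form_ne_zero (hf.null x) (h2 x) hp
    obtain ⟨U, n, hxU, hn, hns⟩ := hν.exists_frame_one x
    have h1 := (form_ne_zero_and_sub_mem_perp (hf.null x) (h2 x) (hνnull x) (hνp x) (hνd x) hv
      hpv (hn.mem x hxU) (hns x hxU).1).2
    exact ⟨-((form v p / form v (n x)) • n x),
      (ν x).neg_mem ((ν x).smul_mem _ (hn.mem x hxU)), by rwa [← sub_eq_add_neg]⟩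
  choose n hn hκ using hex
  have hn0 : ∀ x, n x ≠ 0 := fun x h0 => hpperp x (by simpa [h0] using hκ x)
  -- Although n was chosen pointwise, the condition p + n ∈ f^⊥ determines it within ν. Near x it is
  -- given by a quotient of pairings with a local section ρ of f for which (p, ρ) ≠ 0.
  have hsmooth : ContMDiff (𝓡 2) 𝓘(ℝ, R42) ∞ n := by
    intro x
    obtain ⟨v, hv, hpv⟩ := exists_mem_form_ne_zero (hf.null x) (h2 x) hp
    obtain ⟨V, ρ, hxV, hρ, rfl⟩ := hf.subbundle.exists_section hv
    obtain ⟨U, n₀, hxU, hn₀, hn₀s⟩ := hν.exists_frame_one x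
    have hρx := hρ.smooth.contMDiffAt (hρ.isOpen.mem_nhds hxV)
    have hpρ : ∀ᶠ y in 𝓝 x, form p (ρ y) ≠ 0 := by
      have h1 : ContinuousAt (fun y => form p (ρ y)) x :=
        (mdifferentiableAt_form mdifferentiableAt_const (hρ.mdifferentiableAt hxV)).continuousAt
      exact h1.eventually_ne hpv
    have hform := contMDiffOn_form (hρ.smooth.mono (Set.inter_subset_left (t := U)))
      (hn₀.smooth.mono (Set.inter_subset_right (s := V)))
    have hformp := contMDiffOn_form hρ.smooth (contMDiffOn_const (c := p))
    have hne : ∀ y ∈ V ∩ U, form p (ρ y) ≠ 0 → form (ρ y) (n₀ y) ≠ 0 := fun y hy hy' =>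
      (form_ne_zero_and_sub_mem_perp (hf.null y) (h2 y) (hνnull y) (hνp y) (hνd y)
        (hρ.mem y hy.1) hy' (hn₀.mem y hy.2) (hn₀s y hy.2).1).1
    have hO : V ∩ U ∈ 𝓝 x := (hρ.isOpen.inter hn₀.isOpen).mem_nhds ⟨hxV, hxU⟩
    have hsm : ContMDiffAt (𝓡 2) 𝓘(ℝ, R42) ∞
        (fun y => (-(form (ρ y) p / form (ρ y) (n₀ y))) • n₀ y) x := by
      have hq : ContMDiffAt (𝓡 2) 𝓘(ℝ, ℝ) ∞ (fun y => -(form (ρ y) p / form (ρ y) (n₀ y))) x :=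
        ((hformp.contMDiffAt (hρ.isOpen.mem_nhds hxV)).div₀ (hform.contMDiffAt hO)
          (hne x ⟨hxV, hxU⟩ hpv)).neg
      exact hq.smul (hn₀.smooth.contMDiffAt (hn₀.isOpen.mem_nhds hxU))
    refine hsm.congr_of_eventuallyEq ?_
    filter_upwards [hpρ, hO] with y hy hyO
    have h1 := hn y
    rw [(hn₀s y hyO.2).2] at h1
    obtain ⟨c, hc⟩ := Submodule.mem_span_singleton.1 h1
    have h3 := mem_perp.1 (hκ y) _ (hρ.mem y hyO.1)
    rw [← hc, map_add, map_smul, smul_eq_mul] at h3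
    rw [← hc]
    congr 1
    have := hne y hyO hy
    field_simp
    linarith
  have hnsec : IsSection ν Set.univ n := ⟨isOpen_univ, hsmooth.contMDiffOn, fun y _ => hn y⟩
  have hνspan : ∀ x, ν x = Submodule.span ℝ {n x} := by
    intro x
    obtain ⟨U, n₀, hxU, hn₀, hn₀s⟩ := hν.exists_frame_one x
    have h1 := hn x
    rw [(hn₀s x hxU).2] at h1 ⊢
    obtain ⟨c, hc⟩ := Submodule.mem_span_singleton.1 h1
    have hc0 : c ≠ 0 := by
      rintro rfl
      exact hn0 x (by simpa using hc.symm)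
    rw [← hc, Submodule.span_singleton_smul_eq (IsUnit.mk0 c hc0)]
  have hnd : ∀ x, MDifferentiableAt (𝓡 2) 𝓘(ℝ, R42) n x := fun x =>
    (hsmooth x).mdifferentiableAt (by simp)
  have hκsmooth : ContMDiff (𝓡 2) 𝓘(ℝ, R42) ∞ (fun y => p + n y) :=
    contMDiff_const.add hsmooth
  have hκd : ∀ x (X : TangentSpace (𝓡 2) x),
      dirDeriv (fun y => p + n y) x X = dirDeriv n x X := by
    intro x X
    rw [dirDeriv_add mdifferentiableAt_const (hnd x), dirDeriv_const, zero_add]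
  refine ⟨fun y => p + n y, hκsmooth, hκ, fun x hx => ?_, fun x Z hZ => ?_⟩
  -- If p + n were in f, transversality would make it zero, so p = -n would be null rather than
  -- timelike.
  · have h1 := Submodule.disjoint_def.1 (hνd x) _ hx (Submodule.add_mem _
      (Submodule.mem_sup_right (Submodule.mem_span_singleton_self p))
      (Submodule.mem_sup_left (hn x)))
    have h3 : p ∈ ν x := by
      rw [eq_neg_of_add_eq_zero_left h1]
      exact (ν x).neg_mem (hn x)
    exact hp.ne (form_self_eq_zero_of_null (hνnull x) h3 h3)
  obtain ⟨U, σ, τ, X, Y, hxU, F⟩ := exists_adaptedFrame hf hs i x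
  -- Differentiating (σ, κ) = 0 along X, with d_Xσ in f, gives μ(σ, n) = 0. Here (σ, n) = -(σ, p).
  have hgen : ∀ y ∈ U, form (σ y) p ≠ 0 → dirDeriv (fun y => p + n y) y (X y) = 0 := by
    intro y hy hσp
    have h1 := hνc Set.univ n hnsec y (Set.mem_univ y) _ (F.fieldX.mem y hy)
    rw [hνspan y] at h1
    obtain ⟨μ, hμ⟩ := Submodule.mem_span_singleton.1 h1
    have h3 := form_dirDeriv_add_eq_zero (c := 0) (F.left.mdifferentiableAt hy)
      ((hκsmooth y).mdifferentiableAt (by simp))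
      (by filter_upwards [F.isOpen.mem_nhds hy] with z hz
          exact mem_perp.1 (hκ z) _ ((F.leftf hs).mem z hz)) (X y)
    rw [mem_perp.1 (hκ y) _ (F.dX_left_mem hs hy), zero_add, hκd, ← hμ, map_smul,
      smul_eq_mul] at h3
    have h4 := mem_perp.1 (hκ y) _ ((F.leftf hs).mem y hy)
    rw [map_add] at h4
    have h5 : form (σ y) (n y) ≠ 0 := fun h0 => hσp (by linarith)
    rw [hκd, ← hμ, (mul_eq_zero.1 h3).resolve_right h5, zero_smul]
  -- If d_Xκ ≠ 0 at x, then by continuity and `hgen` (σ, p) vanishes near x, hence so does (d_Xσ, p)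
  -- at x.
  have hX : dirDeriv (fun y => p + n y) x (X x) = 0 := by
    by_contra hne
    have hcont : ContinuousAt (fun y => dirDeriv (fun y => p + n y) y (X y)) x :=
      ((contMDiffOn_dirDeriv F.isOpen hκsmooth.contMDiffOn F.fieldX.smooth).contMDiffAt
        (F.isOpen.mem_nhds hxU)).continuousAt
    have hzero : ∀ᶠ y in 𝓝 x, form (σ y) p = 0 := by
      filter_upwards [hcont.eventually_ne hne, F.isOpen.mem_nhds hxU] with y hy hyU
      by_contra h0
      exact hy (hgen y hyU h0)
    have h1 := form_dirDeriv_add_eq_zero (F.left.mdifferentiableAt hxU)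
      mdifferentiableAt_const hzero (X x)
    rw [dirDeriv_const, map_zero, add_zero] at h1
    have h3 := F.dX_left_mem hs hxU
    have h4 := F.dX_left_notMem hs hreg hxU
    rw [F.span_eq hf hs hxU] at h3
    obtain ⟨a, b, hab⟩ := Submodule.mem_span_pair.1 h3
    -- By regularity d_Xσ is not a multiple of σ, so p is orthogonal to τ as well. Then p lies in
    -- f^⊥, which contains no timelike vector.
    have hb : b ≠ 0 := by
      rintro rfl
      refine h4 ?_
      rw [← hab, zero_smul, add_zero]
      exact (s i x).smul_mem a (F.left.mem x hxU)
    have hσp := hzero.self_of_nhds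
    have hτp : form (τ x) p = 0 := by
      rw [← hab] at h1
      simpa [hσp, hb] using h1
    refine hpperp x (mem_perp.2 fun w hw => ?_)
    rw [F.span_eq hf hs hxU] at hw
    obtain ⟨a, b, rfl⟩ := Submodule.mem_span_pair.1 hw
    simp [hσp, hτp]
  rw [F.spanX x hxU] at hZ
  obtain ⟨k, rfl⟩ := Submodule.mem_span_singleton.1 hZ
  have h1 : dirDeriv (fun y => p + n y) x (k • X x) =
      k • dirDeriv (fun y => p + n y) x (X x) := map_smul _ _ _
  rw [h1, hX, smul_zero]

/-- A nowhere zero smooth map spans a line bundle. -/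
lemma isSubbundle_span_singleton {n : M → R42} (hn : ContMDiff (𝓡 2) 𝓘(ℝ, R42) ∞ n)
    (h0 : ∀ x, n x ≠ 0) : IsSubbundle 1 (fun x => Submodule.span ℝ {n x}) := by
  intro x
  refine ⟨Set.univ, fun _ => n, Set.mem_univ x, fun _ => ⟨isOpen_univ, hn.contMDiffOn,
    fun y _ => Submodule.mem_span_singleton_self _⟩, fun y _ => ⟨?_, ?_⟩⟩
  · exact linearIndependent_unique_iff.2 (h0 y)
  · rw [Set.range_const]

/-- The plane spanned by κ and q has signature (1,1), so the line κ + ℝq meets the light cone in two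
points. One of them, chosen smoothly, spans ν. -/
lemma isSphericalAlong_of_hasParallelComplex {f : M → Submodule ℝ R42} (hf : IsLegendre f)
    {D : Distribution M} {q : R42} (hq : form q q < 0) (h : HasParallelComplex f D) :
    IsSphericalAlong q f D := by
  obtain ⟨κ, hκ, hκp, hκf, hκd⟩ := h
  have hA : ∀ x, 0 < form (κ x) (κ x) := fun x =>
    form_self_pos_of_mem_perp (hf.null x) (hf.subbundle.finrank_eq x) (hκp x) (hκf x)
  -- `r` is a quarter of the discriminant of c ↦ (κ + cq, κ + cq), positive because (κ, κ) > 0 > (q,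
  -- q). The root `c` is the one with (κ + cq, q) = √r, which is therefore nowhere zero.
  let r : M → ℝ := fun x => form (κ x) q * form (κ x) q - form (κ x) (κ x) * form q q
  have hr : ∀ x, 0 < r x := fun x => by
    have := mul_neg_of_pos_of_neg (hA x) hq
    simp only [r]
    nlinarith [mul_self_nonneg (form (κ x) q)]
  let c : M → ℝ := fun x => (Real.sqrt (r x) - form (κ x) q) * (form q q)⁻¹
  have hcq : ∀ x, form (κ x) q + c x * form q q = Real.sqrt (r x) := fun x => by
    simp only [c]
    rw [mul_assoc, inv_mul_cancel₀ hq.ne]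
    ring
  let n : M → R42 := fun x => κ x + c x • q
  have hB : ContMDiff (𝓡 2) 𝓘(ℝ, ℝ) ∞ (fun x => form (κ x) q) :=
    contMDiffOn_univ.1 (contMDiffOn_form hκ.contMDiffOn contMDiffOn_const)
  have hAs : ContMDiff (𝓡 2) 𝓘(ℝ, ℝ) ∞ (fun x => form (κ x) (κ x)) :=
    contMDiffOn_univ.1 (contMDiffOn_form hκ.contMDiffOn hκ.contMDiffOn)
  have hrs : ContMDiff (𝓡 2) 𝓘(ℝ, ℝ) ∞ r := (hB.mul hB).sub (hAs.mul contMDiff_const)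
  have hsq : ContMDiff (𝓡 2) 𝓘(ℝ, ℝ) ∞ (fun x => Real.sqrt (r x)) := fun x =>
    (Real.contDiffAt_sqrt (hr x).ne').contMDiffAt.comp x (hrs x)
  have hcs : ContMDiff (𝓡 2) 𝓘(ℝ, ℝ) ∞ c := (hsq.sub hB).mul contMDiff_const
  have hns : ContMDiff (𝓡 2) 𝓘(ℝ, R42) ∞ n := hκ.add (hcs.smul contMDiff_const)
  have hqn : ∀ x, form (n x) q = Real.sqrt (r x) := fun x => by
    rw [← hcq x]
    simp [n]
  have hnn : ∀ x, form (n x) (n x) = 0 := fun x => by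
    have h1 := Real.mul_self_sqrt (hr x).le
    have h2 : form (n x) (n x) * form q q =
        (form (κ x) q + c x * form q q) * (form (κ x) q + c x * form q q) - r x := by
      simp only [n, r, map_add, map_smul, LinearMap.add_apply, LinearMap.smul_apply, smul_eq_mul,
        form_comm q (κ x)]
      ring
    rw [hcq, h1, sub_self] at h2
    exact (mul_eq_zero.1 h2).resolve_right hq.ne
  have hn0 : ∀ x, n x ≠ 0 := fun x h0 => by
    have h1 := hqn x
    rw [h0, map_zero, LinearMap.zero_apply] at h1
    exact (Real.sqrt_pos.2 (hr x)).ne h1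
  have hsub := isSubbundle_span_singleton hns hn0
  have hnd : ∀ x, MDifferentiableAt (𝓡 2) 𝓘(ℝ, R42) n x := fun x =>
    (hns x).mdifferentiableAt (by simp)
  -- Along D only c can vary, so d_Xn is a multiple of q. Being orthogonal to n while (n, q) ≠ 0, it
  -- vanishes.
  have hn' : ∀ x, ∀ X ∈ D x, dirDeriv n x X = 0 := by
    intro x X hX
    have hcd : MDifferentiableAt (𝓡 2) 𝓘(ℝ, ℝ) c x := (hcs x).mdifferentiableAt (by simp)
    have h1 : dirDeriv n x X = dirDerivReal c x X • q := by
      have h2 := dirDeriv_add ((hκ x).mdifferentiableAt (by simp))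
        (hcd.smul (mdifferentiableAt_const (c := q))) X
      have h3 := dirDeriv_smul hcd (mdifferentiableAt_const (c := q)) X
      rw [dirDeriv_const, smul_zero, zero_add] at h3
      refine h2.trans ?_
      rw [hκd x X hX, zero_add]
      exact h3
    have h2 := form_dirDeriv_add_eq_zero (hnd x) (hnd x) (Filter.Eventually.of_forall hnn) X
    rw [form_comm, h1, map_smul, hqn, smul_eq_mul] at h2
    have h3 : dirDerivReal c x X = 0 := by
      have := Real.sqrt_pos.2 (hr x)
      have h4 : dirDerivReal c x X * Real.sqrt (r x) = 0 := by linarith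
      exact (mul_eq_zero.1 h4).resolve_right this.ne'
    rw [h1, h3, zero_smul]
  refine ⟨fun x => Submodule.span ℝ {n x}, hsub, fun x => ?_, fun U ρ hρ x hx X hX => ?_,
    fun x v hv => ?_, fun x => ?_⟩
  · rw [Submodule.span_singleton_le_iff_mem, mem_perp_span_singleton]
    exact hnn x
  · obtain ⟨a, ha⟩ := Submodule.mem_span_singleton.1 (hρ.mem x hx)
    have hsec : IsSection (fun x => Submodule.span ℝ {n x}) Set.univ n :=
      ⟨isOpen_univ, hns.contMDiffOn, fun y _ => Submodule.mem_span_singleton_self _⟩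
    have h1 := hsub.dirDeriv_sub_mem hρ (hsec.const_smul a) hx (Set.mem_univ x) ha.symm X
    rwa [dirDeriv_const_smul a (hnd x), hn' x X hX, smul_zero, sub_zero] at h1
  · have h1 := mem_perp_span_singleton.1 hv.2
    rw [mem_perp_span_singleton]
    simp only [n, map_add, map_smul, LinearMap.add_apply, LinearMap.smul_apply, h1, smul_zero,
      add_zero]
    rw [form_comm]
    exact mem_perp.1 (hκp x) v hv.1
  -- A vector of f in the span of κ and q is null and orthogonal to κ. In a plane of signature (1,1)
  -- the complement of the spacelike κ is negative definite, so the vector is zero.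
  · rw [Submodule.disjoint_def]
    intro v hv hv'
    obtain ⟨w, hw, u, hu, rfl⟩ := Submodule.mem_sup.1 hv'
    obtain ⟨a, rfl⟩ := Submodule.mem_span_singleton.1 hw
    obtain ⟨b, rfl⟩ := Submodule.mem_span_singleton.1 hu
    have he : a • n x + b • q = a • κ x + (a * c x + b) • q := by
      simp only [n]; module
    rw [he] at hv ⊢
    set e := a * c x + b
    have h1 := mem_perp.1 (hκp x) _ hv
    have h2 := form_self_eq_zero_of_null (hf.null x) hv hv
    simp only [map_add, map_smul, LinearMap.add_apply, LinearMap.smul_apply, smul_eq_mul,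
      form_comm q (κ x)] at h1 h2
    have h3 : e * (a * form (κ x) q + e * form q q) = 0 := by linear_combination h2 - a * h1
    rcases mul_eq_zero.1 h3 with h4 | h4
    · rw [h4, zero_mul, add_zero] at h1
      have ha : a = 0 := (mul_eq_zero.1 h1).resolve_right (hA x).ne'
      rw [ha, h4, zero_smul, zero_smul, add_zero]
    · have h5 : a * a * form (κ x) (κ x) = e * e * form q q := by
        linear_combination a * h1 + -e * h4
      have h6 := mul_nonneg (mul_self_nonneg a) (hA x).le
      have h7 := mul_nonneg (mul_self_nonneg e) (neg_nonneg.2 hq.le)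
      have h8 : e * e * form q q = 0 := by linarith
      have he0 : e = 0 := mul_self_eq_zero.1 ((mul_eq_zero.1 h8).resolve_right hq.ne)
      have ha0 : a = 0 := by
        rw [h8] at h5
        exact mul_self_eq_zero.1 ((mul_eq_zero.1 h5).resolve_right (hA x).ne')
      rw [ha0, he0, zero_smul, zero_smul, add_zero]

/-- Spherical curvature lines do not depend on the conformal geometry. -/
lemma isSphericalAlong_iff_hasParallelComplex [IsManifold (𝓡 2) ∞ M]
    {f : M → Submodule ℝ R42} {s : Fin 2 → M → Submodule ℝ R42}
    (hf : IsLegendre f) (hs : IsUmbilicFree f s) (hreg : IsRegularPair s) {i : Fin 2} {p : R42}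
    (hp : form p p < 0) :
    IsSphericalAlong p f (curvatureBundle f s i) ↔
      HasParallelComplex f (curvatureBundle f s i) :=
  ⟨hasParallelComplex_of_isSphericalAlong hf hs hreg hp,
    isSphericalAlong_of_hasParallelComplex hf hp⟩

end LieSphere
end

noncomputable section

namespace LieSphere

/-! ### Calapso transforms -/

lemma transform_span_singleton {M : Type*} (T : M → R42 →L[ℝ] R42) (x : M) (v : R42)
    {f : M → Submodule ℝ R42}
    (h : f x = Submodule.span ℝ {v}) : transform T f x = Submodule.span ℝ {T x v} := by
  rw [transform, h, Submodule.map_span, Set.image_singleton]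
  rfl

variable {M : Type*} [TopologicalSpace M] [ChartedSpace (EuclideanSpace ℝ (Fin 2)) M]

namespace IsCalapsoGauge

variable {η : EndForm M} {t : ℝ} {T : M → R42 →L[ℝ] R42}

lemma injective (hT : IsCalapsoGauge η t T) (x : M) : Function.Injective (T x) := by
  rw [injective_iff_map_eq_zero]
  intro v hv
  refine eq_zero_of_form_eq_zero fun w => ?_
  rw [← hT.orthogonal x, hv, map_zero]

lemma isUnit (hT : IsCalapsoGauge η t T) (x : M) : IsUnit (T x) := by
  rw [ContinuousLinearMap.isUnit_iff_bijective]
  exact ⟨hT.injective x, (LinearMap.injective_iff_surjective (f := (T x : R42 →ₗ[ℝ] R42))).1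
    (hT.injective x)⟩

lemma apply_inverse (hT : IsCalapsoGauge η t T) (x : M) (v : R42) :
    T x (Ring.inverse (T x) v) = v :=
  congrArg (fun L : R42 →L[ℝ] R42 => L v) (Ring.mul_inverse_cancel _ (hT.isUnit x))

lemma contMDiff_inverse (hT : IsCalapsoGauge η t T) :
    ContMDiff (𝓡 2) 𝓘(ℝ, R42 →L[ℝ] R42) ∞ (fun x => Ring.inverse (T x)) := by
  intro x
  obtain ⟨u, hu⟩ := hT.isUnit x
  have h1 : ContDiffAt ℝ ∞ Ring.inverse (T x) := hu ▸ contDiffAt_ringInverse ℝ u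
  exact h1.contMDiffAt.comp x (hT.smooth x)

lemma mem_transform (hT : IsCalapsoGauge η t T) {f : M → Submodule ℝ R42} {x : M} {v : R42} :
    T x v ∈ transform T f x ↔ v ∈ f x := by
  refine ⟨?_, fun h => Submodule.mem_map_of_mem h⟩
  rintro ⟨w, hw, hwv⟩
  exact hT.injective x hwv ▸ hw

lemma mem_perp_transform (hT : IsCalapsoGauge η t T) {f : M → Submodule ℝ R42} {x : M}
    {v : R42} : T x v ∈ perp (transform T f x) ↔ v ∈ perp (f x) := by
  simp only [mem_perp]
  constructor
  · intro h w hw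
    rw [← hT.orthogonal x]
    exact h _ (hT.mem_transform.2 hw)
  · rintro h _ ⟨w, hw, rfl⟩
    exact (hT.orthogonal x w v).trans (h w hw)

lemma contMDiffOn_apply (hT : IsCalapsoGauge η t T) {U : Set M} {σ : M → R42}
    (hσ : ContMDiffOn (𝓡 2) 𝓘(ℝ, R42) ∞ σ U) :
    ContMDiffOn (𝓡 2) 𝓘(ℝ, R42) ∞ (fun y => T y (σ y)) U :=
  hT.smooth.contMDiffOn.clm_apply hσ

lemma isSection (hT : IsCalapsoGauge η t T) {f : M → Submodule ℝ R42} {U : Set M} {σ : M → R42}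
    (hσ : IsSection f U σ) : IsSection (transform T f) U (fun y => T y (σ y)) :=
  ⟨hσ.isOpen, hT.contMDiffOn_apply hσ.smooth, fun y hy => hT.mem_transform.2 (hσ.mem y hy)⟩

/-- As T has a smooth inverse, all sections of Tf are images of sections of f, so statements about
all sections transfer in both directions. -/
lemma exists_section (hT : IsCalapsoGauge η t T) {f : M → Submodule ℝ R42} {U : Set M}
    {ρ : M → R42} (hρ : IsSection (transform T f) U ρ) :
    ∃ σ, IsSection f U σ ∧ ρ = fun y => T y (σ y) :=
  ⟨fun y => Ring.inverse (T y) (ρ y), ⟨hρ.isOpen,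
    hT.contMDiff_inverse.contMDiffOn.clm_apply hρ.smooth, fun y hy =>
      hT.mem_transform.1 (by rw [hT.apply_inverse]; exact hρ.mem y hy)⟩,
    funext fun y => (hT.apply_inverse y _).symm⟩

lemma isSubbundle (hT : IsCalapsoGauge η t T) {k : ℕ} {f : M → Submodule ℝ R42}
    (hf : IsSubbundle k f) : IsSubbundle k (transform T f) := by
  intro x
  obtain ⟨U, e, hx, he, hfr⟩ := hf x
  refine ⟨U, fun j y => T y (e j y), hx, fun j => hT.isSection (he j), fun y hy => ⟨?_, ?_⟩⟩
  · exact (hfr y hy).1.map' (T y : R42 →ₗ[ℝ] R42) (LinearMap.ker_eq_bot.2 (hT.injective y))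
  · rw [transform, ← (hfr y hy).2, Submodule.map_span, ← Set.range_comp]
    rfl

variable {f : M → Submodule ℝ R42}

/-- A gauge potential annihilates `f`, so that the gauge transformation commutes with the
derivative of sections of `f`. -/
lemma dirDeriv_section (hT : IsCalapsoGauge η t T) (hf : IsLegendre f)
    (hη : ∀ x X, η x X ∈ wedgeSpace (f x) (perp (f x))) {U : Set M} {σ : M → R42}
    (hσ : IsSection f U σ) {x : M} (hx : x ∈ U) (X : TangentSpace (𝓡 2) x) :
    dirDeriv (fun y => T y (σ y)) x X = T x (dirDeriv σ x X) := by
  rw [hT.gauge U σ hσ.isOpen hσ.smooth x hx X,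
    wedgeSpace_apply_eq_zero (hf.null x) (hη x X) (hσ.mem x hx), smul_zero, add_zero]

lemma isLegendre (hT : IsCalapsoGauge η t T) (hf : IsLegendre f)
    (hη : ∀ x X, η x X ∈ wedgeSpace (f x) (perp (f x))) : IsLegendre (transform T f) where
  subbundle := hT.isSubbundle hf.subbundle
  null x := by
    rintro _ ⟨v, hv, rfl⟩
    exact hT.mem_perp_transform.2 (hf.null x hv)
  contact U ρ hρ x hx X := by
    obtain ⟨σ, hσ, rfl⟩ := hT.exists_section hρ
    rw [hT.dirDeriv_section hf hη hσ hx]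
    exact hT.mem_perp_transform.2 (hf.contact U σ hσ x hx X)
  immersed x X h := by
    refine hf.immersed x X fun U σ hσ hx => ?_
    have h1 := h U _ (hT.isSection hσ) hx
    rw [hT.dirDeriv_section hf hη hσ hx] at h1
    exact hT.mem_transform.1 h1

lemma curvatureSpace_eq (hT : IsCalapsoGauge η t T) (hf : IsLegendre f)
    (hη : ∀ x X, η x X ∈ wedgeSpace (f x) (perp (f x))) (g : M → Submodule ℝ R42) (x : M) :
    curvatureSpace (transform T f) (transform T g x) x = curvatureSpace f (g x) x := by
  ext X
  constructor
  · intro h U σ hσ hx hS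
    have h1 := h U _ (hT.isSection hσ) hx (hT.mem_transform.2 hS)
    rw [hT.dirDeriv_section hf hη hσ hx] at h1
    exact hT.mem_transform.1 h1
  · intro h U ρ hρ hx hS
    obtain ⟨σ, hσ, rfl⟩ := hT.exists_section hρ
    rw [hT.dirDeriv_section hf hη hσ hx]
    exact hT.mem_transform.2 (h U σ hσ hx (hT.mem_transform.1 hS))

variable {s : Fin 2 → M → Submodule ℝ R42}

lemma curvatureBundle_eq (hT : IsCalapsoGauge η t T) (hf : IsLegendre f)
    (hη : ∀ x X, η x X ∈ wedgeSpace (f x) (perp (f x))) (i : Fin 2) :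
    curvatureBundle (transform T f) (fun i => transform T (s i)) i = curvatureBundle f s i :=
  funext fun x => hT.curvatureSpace_eq hf hη (s i) x

lemma isUmbilicFree (hT : IsCalapsoGauge η t T) (hf : IsLegendre f) (hs : IsUmbilicFree f s)
    (hη : ∀ x X, η x X ∈ wedgeSpace (f x) (perp (f x))) :
    IsUmbilicFree (transform T f) (fun i => transform T (s i)) where
  subbundle i := hT.isSubbundle (hs.subbundle i)
  curvatureSphere i x := by
    refine ⟨(hT.isSubbundle (hs.subbundle i)).finrank_eq x, Submodule.map_mono (hs.le i x), ?_⟩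
    rw [hT.curvatureSpace_eq hf hη]
    exact (hs.curvatureSphere i x).2.2
  disjoint x := by
    rw [Submodule.disjoint_def]
    rintro _ ⟨v, hv, rfl⟩ hv'
    have := Submodule.disjoint_def.1 (hs.disjoint x) v hv (hT.mem_transform.1 hv')
    simp [this]

lemma isRegularPair (hT : IsCalapsoGauge η t T) (hf : IsLegendre f) (hs : IsUmbilicFree f s)
    (hreg : IsRegularPair s) (hη : ∀ x X, η x X ∈ wedgeSpace (f x) (perp (f x))) :
    IsRegularPair (fun i => transform T (s i)) := by
  intro i x X h
  refine hreg i x X fun U σ hσ hx => ?_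
  have h1 := h U _ (hT.isSection hσ) hx
  rw [hT.dirDeriv_section hf hη (hs.isSection hσ) hx] at h1
  exact hT.mem_transform.1 h1

/-! ### Flatness of the gauged connection and the transfer of both properties -/

variable [IsManifold (𝓡 2) ∞ M]

/-- Since `d + t η` is flat, `t η(A) d_B σ` is symmetric in `A` and `B` for sections `σ` of
`f`. -/
lemma smul_apply_dirDeriv_comm (hT : IsCalapsoGauge η t T) (hf : IsLegendre f)
    (hη : ∀ x X, η x X ∈ wedgeSpace (f x) (perp (f x))) {U : Set M} {σ : M → R42}
    (hσ : IsSection f U σ) {x : M} (hx : x ∈ U) (A B : TangentSpace (𝓡 2) x) :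
    t • η x A (dirDeriv σ x B) = t • η x B (dirDeriv σ x A) := by
  have hxs := mem_chart_source (EuclideanSpace ℝ (Fin 2)) x
  obtain ⟨a, rfl⟩ := exists_coordField_eq hxs A
  obtain ⟨b, rfl⟩ := exists_coordField_eq hxs B
  have hV : IsOpen (U ∩ (chartAt (EuclideanSpace ℝ (Fin 2)) x).source) :=
    hσ.isOpen.inter (chartAt (EuclideanSpace ℝ (Fin 2)) x).open_source
  -- Second derivatives of Tσ are symmetric. Since T commutes with the first derivative of σ, only
  -- the second differentiation produces a term in η.
  have key : ∀ c d : EuclideanSpace ℝ (Fin 2),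
      dirDeriv (fun y => dirDeriv (fun z => T z (σ z)) y (coordField x c y)) x
          (coordField x d x) =
        T x (dirDeriv (fun y => dirDeriv σ y (coordField x c y)) x (coordField x d x) +
          t • η x (coordField x d x) (dirDeriv σ x (coordField x c x))) := by
    intro c d
    have hev : (fun y => dirDeriv (fun z => T z (σ z)) y (coordField x c y)) =ᶠ[𝓝 x]
        fun y => T y (dirDeriv σ y (coordField x c y)) := by
      filter_upwards [hσ.isOpen.mem_nhds hx] with y hy
      exact hT.dirDeriv_section hf hη hσ hy _
    rw [dirDeriv_congr hev]
    exact hT.gauge _ _ hV (contMDiffOn_dirDeriv hV (hσ.smooth.mono Set.inter_subset_left)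
      ((contMDiffOn_coordField x c).mono Set.inter_subset_right)) x ⟨hx, hxs⟩ _
  have h1 := dirDeriv_coordField_comm hσ.isOpen hx (hT.contMDiffOn_apply hσ.smooth) a b
  rw [key, key, dirDeriv_coordField_comm hσ.isOpen hx hσ.smooth] at h1
  exact (add_left_cancel (hT.injective x h1)).symm

variable {i : Fin 2} {U : Set M} {σ τ : M → R42} {X Y : (y : M) → TangentSpace (𝓡 2) y} {y : M}

/-- Symmetry turns this into tη(Y)d_Xσ, and η kills d_Xσ ∈ f. The factor t is kept because the
flatness of d + tη yields nothing about η when t = 0. -/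
lemma smul_dY_eq_zero (hT : IsCalapsoGauge η t T) (hf : IsLegendre f) (hs : IsUmbilicFree f s)
    (hη : ∀ x X, η x X ∈ wedgeSpace (f x) (perp (f x))) (F : AdaptedFrame f s i U σ τ X Y)
    (hy : y ∈ U) : t • η y (X y) (dirDeriv σ y (Y y)) = 0 := by
  rw [hT.smul_apply_dirDeriv_comm hf hη (F.leftf hs) hy, wedgeSpace_apply_eq_zero (hf.null y) (hη y _)
    (F.dX_left_mem hs hy), smul_zero]

/-- Such a v is a multiple of d_Yσ modulo f, and tη(X) kills both. -/
lemma smul_eq_zero_of_mem_perp (hT : IsCalapsoGauge η t T) (hf : IsLegendre f)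
    (hs : IsUmbilicFree f s) (hη : ∀ x X, η x X ∈ wedgeSpace (f x) (perp (f x)))
    (F : AdaptedFrame f s i U σ τ X Y) (hy : y ∈ U) {v : R42} (hv : v ∈ perp (f y))
    (hvX : form v (dirDeriv τ y (X y)) = 0) : t • η y (X y) v = 0 := by
  obtain ⟨c, hc⟩ := F.sub_smul_mem hf hs hy hv hvX
  have h1 := wedgeSpace_apply_eq_zero (hf.null y) (hη y (X y)) hc
  rw [map_sub, map_smul, sub_eq_zero] at h1
  rw [h1, smul_comm t c, hT.smul_dY_eq_zero hf hs hη F hy, smul_zero]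

lemma adaptedFrame (hT : IsCalapsoGauge η t T) (hf : IsLegendre f)
    (hη : ∀ x X, η x X ∈ wedgeSpace (f x) (perp (f x))) (F : AdaptedFrame f s i U σ τ X Y) :
    AdaptedFrame (transform T f) (fun i => transform T (s i)) i U (fun y => T y (σ y))
      (fun y => T y (τ y)) X Y where
  left := hT.isSection F.left
  right := hT.isSection F.right
  span_left y hy := transform_span_singleton T y _ (F.span_left y hy)
  span_right y hy := transform_span_singleton T y _ (F.span_right y hy)
  left_ne y hy h := F.left_ne y hy (hT.injective y (h.trans (map_zero _).symm))
  fieldX := by rw [hT.curvatureBundle_eq hf hη]; exact F.fieldX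
  fieldY := by rw [hT.curvatureBundle_eq hf hη]; exact F.fieldY
  spanX := by rw [hT.curvatureBundle_eq hf hη]; exact F.spanX
  spanY := by rw [hT.curvatureBundle_eq hf hη]; exact F.spanY
  X_ne := F.X_ne
  Y_ne := F.Y_ne

/-- The frame description of the complex uses σ, d_Yσ, d_Xσ and d_Xd_Yσ. T commutes with all of
these, with the last one because tη(X)d_Yσ = 0. -/
lemma osculatingComplex_eq (hT : IsCalapsoGauge η t T) (hf : IsLegendre f)
    (hs : IsUmbilicFree f s) (hη : ∀ x X, η x X ∈ wedgeSpace (f x) (perp (f x))) (i : Fin 2) :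
    osculatingComplex (transform T f) (fun i => transform T (s i)) i =
      transform T (osculatingComplex f s i) := by
  funext y
  ext v
  obtain ⟨U, σ, τ, X, Y, hy, F⟩ := exists_adaptedFrame hf hs i y
  obtain ⟨w, rfl⟩ : ∃ w, T y w = v := ⟨_, hT.apply_inverse y v⟩
  rw [hT.mem_transform, F.mem_osculatingComplex_iff hf hs hy,
    (hT.adaptedFrame hf hη F).mem_osculatingComplex_iff (hT.isLegendre hf hη)
      (hT.isUmbilicFree hf hs hη) hy]
  have hd : ∀ Z : TangentSpace (𝓡 2) y,
      dirDeriv (fun z => T z (σ z)) y Z = T y (dirDeriv σ y Z) :=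
    hT.dirDeriv_section hf hη (F.leftf hs) hy
  have hdd : dirDeriv (fun z => dirDeriv (fun z => T z (σ z)) z (Y z)) y (X y) =
      T y (dirDeriv (fun z => dirDeriv σ z (Y z)) y (X y)) := by
    have hev : (fun z => dirDeriv (fun z => T z (σ z)) z (Y z)) =ᶠ[𝓝 y]
        fun z => T z (dirDeriv σ z (Y z)) := by
      filter_upwards [F.isOpen.mem_nhds hy] with z hz
      exact hT.dirDeriv_section hf hη (F.leftf hs) hz _
    rw [dirDeriv_congr hev, hT.gauge U _ F.isOpen F.contMDiffOn_dY y hy (X y),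
      hT.smul_dY_eq_zero hf hs hη F hy, add_zero]
  simp only [hd, hdd, ← map_smul, ← map_add, (hT.injective y).eq_iff]

/-- Differentiate (τ, κ) = 0 along X. Membership of d_Xκ in f^⊥ suffices, which matters when only Tκ
is known to be constant. -/
lemma form_dX_right_eq_zero (hs : IsUmbilicFree f s) (F : AdaptedFrame f s i U σ τ X Y)
    (hy : y ∈ U) {κ : M → R42} (hκ : ContMDiff (𝓡 2) 𝓘(ℝ, R42) ∞ κ)
    (hκp : ∀ x, κ x ∈ perp (f x)) (h : dirDeriv κ y (X y) ∈ perp (f y)) :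
    form (κ y) (dirDeriv τ y (X y)) = 0 := by
  have h1 := form_dirDeriv_add_eq_zero (c := 0) (F.right.mdifferentiableAt hy)
    ((hκ y).mdifferentiableAt (by simp))
    (by filter_upwards [F.isOpen.mem_nhds hy] with z hz
        exact mem_perp.1 (hκp z) _ ((F.rightf hs).mem z hz)) (X y)
  rw [mem_perp.1 h _ ((F.rightf hs).mem y hy), add_zero] at h1
  rw [form_comm, h1]

/-- The correspondence is κ ↦ Tκ: it preserves constancy along X because tη(X)κ = 0. -/
lemma hasParallelComplex_iff (hT : IsCalapsoGauge η t T) (hf : IsLegendre f)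
    (hs : IsUmbilicFree f s) (hη : ∀ x X, η x X ∈ wedgeSpace (f x) (perp (f x))) (i : Fin 2) :
    HasParallelComplex (transform T f) (curvatureBundle f s i) ↔
      HasParallelComplex f (curvatureBundle f s i) := by
  have hgauge : ∀ (κ : M → R42), ContMDiff (𝓡 2) 𝓘(ℝ, R42) ∞ κ → ∀ x (X : TangentSpace (𝓡 2) x),
      dirDeriv (fun y => T y (κ y)) x X = T x (dirDeriv κ x X + t • η x X (κ x)) :=
    fun κ hκ x X => hT.gauge Set.univ κ isOpen_univ hκ.contMDiffOn x (Set.mem_univ x) X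
  constructor
  · rintro ⟨κ', hκ', hκp', hκf', hκd'⟩
    obtain ⟨κ, hκ, rfl⟩ : ∃ κ, ContMDiff (𝓡 2) 𝓘(ℝ, R42) ∞ κ ∧ κ' = fun y => T y (κ y) :=
      ⟨fun y => Ring.inverse (T y) (κ' y), hT.contMDiff_inverse.clm_apply hκ',
        funext fun y => (hT.apply_inverse y _).symm⟩
    have hκp : ∀ x, κ x ∈ perp (f x) := fun x => hT.mem_perp_transform.1 (hκp' x)
    refine ⟨κ, hκ, hκp, fun x hx => hκf' x (hT.mem_transform.2 hx), fun x Z hZ => ?_⟩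
    obtain ⟨U, σ, τ, X, Y, hx, F⟩ := exists_adaptedFrame hf hs i x
    have h1 := hκd' x _ (F.fieldX.mem x hx)
    rw [hgauge κ hκ] at h1
    have h2 : dirDeriv κ x (X x) + t • η x (X x) (κ x) = 0 :=
      hT.injective x (h1.trans (map_zero _).symm)
    -- Constancy of Tκ gives d_Xκ = -tη(X)κ, which lies in f since η maps f^⊥ into f.
    have h3 : dirDeriv κ x (X x) ∈ perp (f x) := by
      rw [eq_neg_of_add_eq_zero_left h2]
      exact hf.null x ((f x).neg_mem ((f x).smul_mem t
        (wedgeSpace_apply_mem (hη x (X x)) (hκp x))))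
    have h4 := hT.smul_eq_zero_of_mem_perp hf hs hη F hx (hκp x)
      (form_dX_right_eq_zero hs F hx hκ hκp h3)
    rw [h4, add_zero] at h2
    rw [F.spanX x hx] at hZ
    obtain ⟨k, rfl⟩ := Submodule.mem_span_singleton.1 hZ
    have h5 : dirDeriv κ x (k • X x) = k • dirDeriv κ x (X x) := map_smul _ _ _
    rw [h5, h2, smul_zero]
  · rintro ⟨κ, hκ, hκp, hκf, hκd⟩
    refine ⟨fun y => T y (κ y), hT.smooth.clm_apply hκ, fun x => hT.mem_perp_transform.2 (hκp x),
      fun x hx => hκf x (hT.mem_transform.1 hx), fun x Z hZ => ?_⟩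
    obtain ⟨U, σ, τ, X, Y, hx, F⟩ := exists_adaptedFrame hf hs i x
    rw [hgauge κ hκ, hκd x Z hZ, zero_add]
    have h1 := hκd x _ (F.fieldX.mem x hx)
    have h2 := form_dX_right_eq_zero hs F hx hκ hκp (h1 ▸ Submodule.zero_mem _)
    have h3 := hT.smul_eq_zero_of_mem_perp hf hs hη F hx (hκp x) h2
    rw [F.spanX x hx] at hZ
    obtain ⟨k, rfl⟩ := Submodule.mem_span_singleton.1 hZ
    have h4 : η x (k • X x) (κ x) = k • η x (X x) (κ x) :=
      congrArg (fun L : R42 →L[ℝ] R42 => L (κ x)) (map_smul (η x) k (X x))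
    rw [h4, smul_comm t k, h3, smul_zero, map_zero]

end IsCalapsoGauge

end LieSphere
end

open LieSphere
theorem mainTheorem11 {M : Type*} [TopologicalSpace M]
    [ChartedSpace (EuclideanSpace ℝ (Fin 2)) M] [IsManifold (𝓡 2) ∞ M]
    (f : M → Submodule ℝ R42) (s : Fin 2 → M → Submodule ℝ R42)
    (hf : IsLegendre f) (hs : IsUmbilicFree f s) (hreg : IsRegularPair s)
    (η : EndForm M) (hη : IsGaugePotential f η)
    (t : ℝ) (T : M → R42 →L[ℝ] R42) (hT : IsCalapsoGauge η t T) :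
    -- the Calapso transform is again a regular umbilic-free Legendre map,
    -- with curvature spheres `T s_i` and the same curvature subbundles
    (IsLegendre (transform T f) ∧
      IsUmbilicFree (transform T f) (fun i => transform T (s i)) ∧
      IsRegularPair (fun i => transform T (s i)) ∧
      ∀ i, curvatureBundle (transform T f) (fun i => transform T (s i)) i
        = curvatureBundle f s i) ∧
    -- spherical curvature lines, in whichever conformal geometries they are tested
    (∀ (i : Fin 2) (p q : R42), form p p < 0 → form q q < 0 →
      (IsSphericalAlong p f (curvatureBundle f s i) ↔
        IsSphericalAlong q (transform T f) (curvatureBundle f s i))) ∧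
    -- osculating complexes
    (∀ i : Fin 2,
      osculatingComplex (transform T f) (fun i => transform T (s i)) i
        = transform T (osculatingComplex f s i)) := by
  have hf' := hT.isLegendre hf hη.mem
  have hs' := hT.isUmbilicFree hf hs hη.mem
  have hreg' := hT.isRegularPair hf hs hreg hη.mem
  have hbundle := hT.curvatureBundle_eq (s := s) hf hη.mem
  refine ⟨⟨hf', hs', hreg', hbundle⟩, fun i p q hp hq => ?_,
    hT.osculatingComplex_eq hf hs hη.mem⟩
  -- The geometries p and q disappear on passing to parallel complexes, so they may differ on the
  -- two sides.
  have h := isSphericalAlong_iff_hasParallelComplex hf' hs' hreg' (i := i) hq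
  rw [hbundle i] at h
  rw [isSphericalAlong_iff_hasParallelComplex hf hs hreg hp, h,
    hT.hasParallelComplex_iff hf hs hη.mem]
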